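/- **Notation.** All spaces are Euclidean. For a set $\Omega$ let $\Pi_\Omega(x)$ be the set of points of $\Omega$ nearest to $x$. The limiting normal cone to $\Omega$ at $\bar x\in\Omega$ is $$N_\Omega(\bar x)=\{v:\ \exists\,x_k\to\bar x,\ w_k\in\Pi_\Omega(x_k),\ \alpha_k\ge 0\ \text{ with }\ \alpha_k(x_k-w_k)\to v\},$$ and $N_\Omega(\bar x)=\emptyset$ if $\bar x\notin\Omega$. The coderivative of a set-valued mapping $F$ at a point $(\bar x,\bar y)$ of its graph is $D^*F(\bar x,\bar y)(z)=\{v:\ (v,-z)\in N_{\mathrm{gph}\,F}(\bar x,\bar y)\}$, and $\operatorname{dom}D^*F(\bar x,\bar y)=\{z:\ D^*F(\bar x,\bar y)(z)\neq\emptyset\}$. The sign $^*$ on a matrix is transposition. **Theorem.** Let $f_1:\mathbb R^m\times\mathbb R^n\to\mathbb R^n$, $f_2:\mathbb R^d\times\mathbb R^n\to\mathbb R^n$, $g=(g_1,\dots,g_s):\mathbb R^n\to\mathbb R^s$, $C=\{x\in\mathbb R^n:\ g_i(x)\ge 0,\ i=1,\dots,s\}$, $h>0$, and let $F_h:\mathbb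 R^{3n+m+d}\rightrightarrows\mathbb R^n$ be $$F_h(x,y,u,a,b)=N_C(x-u)+f_1(a,x)+y+hf_2(b,x).$$ Let $(x,y,u,a,b)$ satisfy $x-u\in C$, let $w\in F_h(x,y,u,a,b)$, and put $v:=w-f_1(a,x)-y-hf_2(b,x)$. Suppose that $f_1$ is $\mathcal C^1$ around $(a,x)$, that $f_2$ is $\mathcal C^1$ around $(b,x)$, that $g$ is $\mathcal C^2$ around $x-u$, and that the $s\times n$ Jacobian matrix $\nabla g(x-u)$ has full row rank $s$. Then: 1. There is a unique $\lambda\in\mathbb R^s$ with nonnegative components such that $-\nabla g(x-u)^*\lambda=v$. 2. The domain of the coderivative of $N_C$ at $(x-u,v)$ is $$\operatorname{dom}D^*N_C(x-u,v)=\big\{z\in\mathbb R^n:\ \exists\,\lambda\in\mathbb R^s_+\ \text{with}\ -\nabla g(x-u)^*\lambda=v\ \text{and}\ \lambda_i\langle\nabla g_i(x-u),z\rangle=0,\ i=1,\dots,s\big\}.$$ 3. With $\lambda$ from 1, for every $z\in\operatorname{dom}D^*N_C(x-u,v)$ the set $D^*F_h(x,y,u,a,b,w)(z)$ consists exactly of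 the vectors with the $(x,y,u,a,b)$-components $$\Big(\nabla_xf_1(a,x)^*z+h\nabla_xf_2(b,x)^*z-\Big(\sum_{i=1}^s\lambda_i\nabla^2g_i(x-u)\Big)z-\nabla g(x-u)^*\sigma,\ \ z,\ \ \Big(\sum_{i=1}^s\lambda_i\nabla^2g_i(x-u)\Big)z+\nabla g(x-u)^*\sigma,\ \ \nabla_af_1(a,x)^*z,\ \ h\nabla_bf_2(b,x)^*z\Big),$$ where $\sigma$ runs through all vectors of $\mathbb R^s$ such that, for each $i=1,\dots,s$: $\sigma_i=0$ if $g_i(x-u)>0$, or if $\lambda_i=0$ and $\langle\nabla g_i(x-u),z\rangle>0$; and $\sigma_i\ge 0$ if $g_i(x-u)=0$, $\lambda_i=0$ and $\langle\nabla g_i(x-u),z\rangle<0$. -/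

import Mathlib

namespace Sweeping

noncomputable section

/-- The Euclidean space `ℝⁿ`. -/
abbrev E (n : ℕ) : Type := EuclideanSpace ℝ (Fin n)

/-- The Euclidean projection `Π_Ω(x)`: all points of `Ω` nearest to `x` (possibly none or many). -/
def proj {X : Type*} [NormedAddCommGroup X] (Ω : Set X) (x : X) : Set X :=
  {w | w ∈ Ω ∧ dist x w = Metric.infDist x Ω}

/-- The basic (limiting, Mordukhovich) normal cone to `Ω` at `xbar`: the limits of
`αₖ (xₖ - wₖ)` with `xₖ → xbar`, `wₖ ∈ Π_Ω(xₖ)`, `αₖ ≥ 0`; it is empty when `xbar ∉ Ω`. -/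
def normalCone {X : Type*} [NormedAddCommGroup X] [InnerProductSpace ℝ X]
    (Ω : Set X) (xbar : X) : Set X :=
  {v | xbar ∈ Ω ∧ ∃ (x w : ℕ → X) (α : ℕ → ℝ),
    Filter.Tendsto x Filter.atTop (nhds xbar) ∧
    (∀ k, w k ∈ proj Ω (x k)) ∧ (∀ k, 0 ≤ α k) ∧
    Filter.Tendsto (fun k => α k • (x k - w k)) Filter.atTop (nhds v)}

/-- The graph of a set-valued mapping, inside the Euclidean (`ℓ²`) product. -/
def gph {X Y : Type*} (F : X → Set Y) : Set (WithLp 2 (X × Y)) :=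
  {p | p.snd ∈ F p.fst}

/-- The coderivative `D*F(xbar, ybar)(z) = {v | (v, -z) ∈ N_{gph F}(xbar, ybar)}`. -/
def coderivative {X Y : Type*} [NormedAddCommGroup X] [InnerProductSpace ℝ X]
    [NormedAddCommGroup Y] [InnerProductSpace ℝ Y]
    (F : X → Set Y) (xbar : X) (ybar : Y) (z : Y) : Set X :=
  {v | WithLp.toLp 2 (v, -z) ∈ normalCone (gph F) (WithLp.toLp 2 (xbar, ybar))}

/-- The domain `{x | F(x) ≠ ∅}` of a set-valued mapping. -/
def dom {X Y : Type*} (F : X → Set Y) : Set X := {x | (F x).Nonempty}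

/-- `ℝ^{3n+m+d}` as the Euclidean product of the variables `(x, y, u, a, b)`. -/
abbrev Var (n m d : ℕ) : Type :=
  WithLp 2 (E n × WithLp 2 (E n × WithLp 2 (E n × WithLp 2 (E m × E d))))

/-- The point `(x, y, u, a, b)` of `ℝ^{3n+m+d}`. -/
def var {n m d : ℕ} (x y u : E n) (a : E m) (b : E d) : Var n m d :=
  WithLp.toLp 2 (x, WithLp.toLp 2 (y, WithLp.toLp 2 (u, WithLp.toLp 2 (a, b))))

/-- The constraint set `C = {x | gᵢ(x) ≥ 0, i = 1, …, s}`. -/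
def constraintSet {n s : ℕ} (g : E n → E s) : Set (E n) := {x | ∀ i, 0 ≤ g x i}

/-- The set-valued mapping
`F_h(x, y, u, a, b) = N_C(x - u) + f₁(a, x) + y + h f₂(b, x)`. -/
def velocity {n m d s : ℕ} (f₁ : E m → E n → E n) (f₂ : E d → E n → E n) (g : E n → E s)
    (h : ℝ) (q : Var n m d) : Set (E n) :=
  let x := q.fst
  let y := q.snd.fst
  let u := q.snd.snd.fst
  let a := q.snd.snd.snd.fst
  let b := q.snd.snd.snd.snd
  (fun v => v + f₁ a x + y + h • f₂ b x) '' normalCone (constraintSet g) (x - u)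

/-- The gradient `∇gᵢ(p)` of the `i`-th component of `g`. -/
def grad {n s : ℕ} (g : E n → E s) (i : Fin s) (p : E n) : E n :=
  gradient (fun q => g q i) p

/-- The Hessian `∇²gᵢ(p)` of the `i`-th component of `g`, as a linear operator. -/
def hess {n s : ℕ} (g : E n → E s) (i : Fin s) (p : E n) : E n →L[ℝ] E n :=
  fderiv ℝ (grad g i) p

/-- The transposed Jacobian `∇f(p)^*` of a mapping between Euclidean spaces. -/
def jacT {k l : ℕ} (f : E k → E l) (p : E k) : E l →L[ℝ] E k :=
  ContinuousLinearMap.adjoint (fderiv ℝ f p)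

/-- `μ` is a vector with nonnegative components such that `-∇g(p)^* μ = v`. -/
def IsMultiplier {n s : ℕ} (g : E n → E s) (p v : E n) (μ : E s) : Prop :=
  (∀ i, 0 ≤ μ i) ∧ -(jacT g p μ) = v

/-- The sign conditions on `σ` relative to the point `p`, the multiplier `μ` and the
direction `z`. -/
def SignConditions {n s : ℕ} (g : E n → E s) (p : E n) (μ : E s) (z : E n) (σ : E s) : Prop :=
  ∀ i,
    ((0 < g p i ∨ (μ i = 0 ∧ 0 < inner ℝ (grad g i p) z)) → σ i = 0) ∧
    ((g p i = 0 ∧ μ i = 0 ∧ inner ℝ (grad g i p) z < 0) → 0 ≤ σ i)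

end

end Sweeping

open Sweeping

/-! For a locally closed set, limiting normals are the limits of regular (Fréchet) normals
(`mem_normalCone_iff_closure`). Regular normals are easy to transport along maps, and this yields
the preimage rule `mem_normalCone_preimage_iff`: if `Φ` is C¹ with surjective derivative `A` at `x`,
the normal cone to `Φ⁻¹(Ω)` at `x` is the image under `A^*` of the normal cone to `Ω` at `Φ x`.
Everything else is this rule applied to suitable maps.

For the orthant the rule gives `N_C(x) = {∇g(x)^* μ : 0 ≤ g(x) ⊥ μ ≤ 0}`; the multiplier is unique
because `∇g(x)^*` is injective. For the graph of `N_C` near `(p, ∇g(p)^* μ)`, let `K = ker ∇g(p)`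
and parametrize by `(x, μ, κ) ↦ (x, ∇g(x)^* μ + κ)` with `κ ∈ K`. The factor `K` makes the
derivative surjective, since `im ∇g(p)^* + K` is the whole space. The set of parameters landing in
the graph is also, near the base point, the preimage of `{0 ≤ q ⊥ μ ≤ 0, κ = 0}` under `(x, μ, κ) ↦
(g(x), μ, κ)`. Applying the rule to both descriptions expresses normals to `gph N_C` through those
of the complementarity set, which split into planar computations, one for each index. The Hessian
term comes from differentiating `∇g(x)^* μ` in `x`.

Finally `gph F_h` is the preimage of `gph N_C` under `(x, y, u, a, b, w) ↦ (x - u, w - f₁(a, x) - y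
- h f₂(b, x))`, whose derivative is surjective, so a third use of the rule gives the coderivative of
`F_h`. -/

open Sweeping
open Filter Topology

namespace Sweeping

/-! ### Regular normals and their limits -/

section RegularNormals

/-- `Ω` agrees with a closed set near `x`. -/
def ClosedNear {X : Type*} [TopologicalSpace X] (Ω : Set X) (x : X) : Prop :=
  ∃ U ∈ 𝓝 x, IsClosed (Ω ∩ U)

theorem ClosedNear.eventually {X : Type*} [TopologicalSpace X] {Ω : Set X} {x : X}
    (h : ClosedNear Ω x) : ∀ᶠ y in 𝓝 x, ClosedNear Ω y := by
  obtain ⟨U, hU, hc⟩ := h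
  filter_upwards [eventually_mem_nhds_iff.2 hU] with y hy
  exact ⟨U, hy, hc⟩

theorem ClosedNear.preimage {X Y : Type*} [TopologicalSpace X] [RegularSpace X]
    [TopologicalSpace Y] {S : Set X} {Ω : Set Y} {Φ : X → Y} {x : X}
    (hΦ : ∀ᶠ x' in 𝓝 x, ContinuousAt Φ x') (hΩ : ClosedNear Ω (Φ x))
    (hS : ∀ᶠ x' in 𝓝 x, x' ∈ S ↔ Φ x' ∈ Ω) : ClosedNear S x := by
  obtain ⟨U, hU, hc⟩ := hΩ
  have h1 := hΦ.and (hS.and (hΦ.self_of_nhds.eventually hU))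
  obtain ⟨B, ⟨hB, hBc⟩, hBs⟩ := (closed_nhds_basis x).mem_iff.1 h1
  refine ⟨B, hB, ?_⟩
  have h2 : S ∩ B = B ∩ Φ ⁻¹' (Ω ∩ U) := by
    ext y
    constructor
    · rintro ⟨hy, hyB⟩
      exact ⟨hyB, (hBs hyB).2.1.1 hy, (hBs hyB).2.2⟩
    · rintro ⟨hyB, hy, -⟩
      exact ⟨(hBs hyB).2.1.2 hy, hyB⟩
  rw [h2]
  exact ContinuousOn.preimage_isClosed_of_isClosed
    (fun y hy => (hBs hy).1.continuousWithinAt) hBc hc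

/-- Project onto the closed piece `Ω ∩ U`. For `x` close to `w`, points of `Ω` outside `U` are
farther from `x` than `w` is, so they cannot compete. -/
theorem eventually_proj_nonempty {X : Type*} [NormedAddCommGroup X] [ProperSpace X] {Ω : Set X} {w : X} (hw : w ∈ Ω)
    (hΩ : ClosedNear Ω w) : ∀ᶠ x in 𝓝 w, (proj Ω x).Nonempty := by
  obtain ⟨U, hU, hc⟩ := hΩ
  obtain ⟨r, hr, hrU⟩ := Metric.mem_nhds_iff.1 hU
  filter_upwards [Metric.ball_mem_nhds w (half_pos hr)] with x hx
  have hne : (Ω ∩ U).Nonempty := ⟨w, hw, mem_of_mem_nhds hU⟩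
  obtain ⟨u, hu, hd⟩ := hc.exists_infDist_eq_dist hne x
  refine ⟨u, hu.1, le_antisymm ?_ (Metric.infDist_le_dist_of_mem hu.1)⟩
  refine (Metric.le_infDist ⟨w, hw⟩).2 fun y hy => ?_
  by_cases hyU : y ∈ U
  · rw [← hd]; exact Metric.infDist_le_dist_of_mem ⟨hy, hyU⟩
  · have h1 : r ≤ dist y w := by
      by_contra! h; exact hyU (hrU h)
    have h2 : dist x u ≤ dist x w := by
      rw [← hd]; exact Metric.infDist_le_dist_of_mem ⟨hw, mem_of_mem_nhds hU⟩
    have h3 := dist_triangle y x w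
    rw [dist_comm y x] at h3
    rw [Metric.mem_ball] at hx
    linarith

variable {X : Type*} [NormedAddCommGroup X] [InnerProductSpace ℝ X]

/-- The regular (Fréchet) normal cone. -/
def regularNormalCone (Ω : Set X) (w : X) : Set X :=
  {v | w ∈ Ω ∧ ∀ ε : ℝ, 0 < ε → ∀ᶠ y in 𝓝 w, y ∈ Ω → inner ℝ v (y - w) ≤ ε * ‖y - w‖}

/-- Expanding `‖x - y‖² ≥ ‖x - w‖²` gives a bound quadratic in `‖y - w‖`, hence eventually below `ε
* ‖y - w‖`. -/
theorem smul_sub_mem_regularNormalCone {Ω : Set X} {x w : X} (hw : w ∈ proj Ω x) {α : ℝ}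
    (hα : 0 ≤ α) : α • (x - w) ∈ regularNormalCone Ω w := by
  refine ⟨hw.1, fun ε hε => ?_⟩
  have h1 : ∀ᶠ y in 𝓝 w, α * ‖y - w‖ < ε := by
    have : Tendsto (fun y : X => α * ‖y - w‖) (𝓝 w) (𝓝 (α * ‖w - w‖)) :=
      (by fun_prop : Continuous fun y : X => α * ‖y - w‖).tendsto w
    rw [sub_self, norm_zero, mul_zero] at this
    exact this.eventually (gt_mem_nhds hε)
  filter_upwards [h1] with y hy hyΩ
  have h2 : ‖x - w‖ ≤ ‖x - y‖ := by
    rw [← dist_eq_norm, ← dist_eq_norm, hw.2]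
    exact Metric.infDist_le_dist_of_mem hyΩ
  have h3 : ‖x - y‖ ^ 2 = ‖x - w‖ ^ 2 - 2 * inner ℝ (x - w) (y - w) + ‖y - w‖ ^ 2 := by
    rw [← norm_sub_sq_real]; congr 2; abel
  have h4 : ‖x - w‖ ^ 2 ≤ ‖x - y‖ ^ 2 := by gcongr
  have h5 : inner ℝ (x - w) (y - w) ≤ ‖y - w‖ * ‖y - w‖ := by nlinarith [sq_nonneg ‖y - w‖]
  rw [real_inner_smul_left]
  calc α * inner ℝ (x - w) (y - w) ≤ α * (‖y - w‖ * ‖y - w‖) := by gcongr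
    _ = (α * ‖y - w‖) * ‖y - w‖ := by ring
    _ ≤ ε * ‖y - w‖ := by gcongr

/-- The pairs of a base point near which we project and a proximal normal vector. -/
def proximalPairs (Ω : Set X) : Set (X × X) :=
  {p | ∃ w ∈ proj Ω p.1, ∃ α : ℝ, 0 ≤ α ∧ p.2 = α • (p.1 - w)}

/-- Writing the sequential definition as a closure makes diagonal arguments and closedness of the
graph immediate; no closedness of `Ω` is needed. -/
theorem mem_normalCone_iff_closure_proximalPairs {Ω : Set X} {x v : X} :
    v ∈ normalCone Ω x ↔ x ∈ Ω ∧ (x, v) ∈ closure (proximalPairs Ω) := by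
  rw [mem_closure_iff_seq_limit]
  refine and_congr_right fun _ => ⟨?_, ?_⟩
  · rintro ⟨xs, ws, α, h1, h2, h3, h4⟩
    exact ⟨fun k => (xs k, α k • (xs k - ws k)), fun k => ⟨ws k, h2 k, α k, h3 k, rfl⟩,
      h1.prodMk_nhds h4⟩
  · rintro ⟨p, hp, hlim⟩
    choose ws hws α hα he using hp
    refine ⟨fun k => (p k).1, ws, α, (continuous_fst.tendsto _).comp hlim, hws, hα, ?_⟩
    simp_rw [← he]
    exact (continuous_snd.tendsto _).comp hlim

/-- Project `w + t v` to a point `u` of `Ω`. Regularity of `v` forces `‖u - w‖` to be small relative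
to `t`, so the proximal normal `t⁻¹ (w + t v - u)` is close to `v`. -/
theorem regularNormal_mem_closure_proximalPairs [ProperSpace X] {Ω : Set X} {w v : X}
    (hv : v ∈ regularNormalCone Ω w) (hΩ : ClosedNear Ω w) :
    (w, v) ∈ closure (proximalPairs Ω) := by
  rw [Metric.mem_closure_iff]
  intro ε hε
  obtain ⟨hw, hv⟩ := hv
  -- Comparing distances gives `‖u - w‖² ≤ 2 t ⟨v, u - w⟩`, so `ε / 4` yields `‖u - w‖ ≤ t ε / 2`.
  have h1 := hv (ε / 4) (by linarith)
  obtain ⟨r, hr, hball⟩ := Metric.eventually_nhds_iff.1 h1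
  have hlim : Tendsto (fun t : ℝ => w + t • v) (𝓝[>] 0) (𝓝 w) := by
    have : Tendsto (fun t : ℝ => w + t • v) (𝓝 0) (𝓝 (w + (0 : ℝ) • v)) :=
      (by fun_prop : Continuous fun t : ℝ => w + t • v).tendsto 0
    rw [zero_smul, add_zero] at this
    exact this.mono_left nhdsWithin_le_nhds
  have h2 := hlim.eventually ((eventually_proj_nonempty hw hΩ).and
    (inter_mem (Metric.ball_mem_nhds w hε) (Metric.ball_mem_nhds w (half_pos hr))))
  obtain ⟨t, ⟨⟨u, hu⟩, ht1, ht2⟩, ht⟩ := (h2.and self_mem_nhdsWithin).exists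
  have ht : 0 < t := ht
  refine ⟨(w + t • v, t⁻¹ • (w + t • v - u)), ⟨u, hu, t⁻¹, by positivity, rfl⟩, ?_⟩
  have hle : dist (w + t • v) u ≤ dist (w + t • v) w := by
    rw [hu.2]; exact Metric.infDist_le_dist_of_mem hw
  have hur : dist u w < r := by
    have := dist_triangle_left u w (w + t • v)
    rw [Metric.mem_ball] at ht2
    linarith
  have h3 := hball hur hu.1
  have h4 : ‖t • v - (u - w)‖ ≤ ‖t • v‖ := by
    rw [dist_eq_norm, dist_eq_norm] at hle
    rwa [show w + t • v - u = t • v - (u - w) by abel, add_sub_cancel_left] at hle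
  have h5 : ‖t • v - (u - w)‖ ^ 2 ≤ ‖t • v‖ ^ 2 := by gcongr
  rw [norm_sub_sq_real, real_inner_smul_left] at h5
  have h6 : ‖u - w‖ ^ 2 ≤ (t * ε / 2) * ‖u - w‖ := by nlinarith
  have h7 : ‖u - w‖ ≤ t * ε / 2 := by
    rcases (norm_nonneg (u - w)).eq_or_lt with h | h
    · rw [← h]; positivity
    · nlinarith
  have h8 : dist v (t⁻¹ • (w + t • v - u)) < ε := by
    have : v - t⁻¹ • (w + t • v - u) = t⁻¹ • (u - w) := by
      rw [show w + t • v - u = t • v - (u - w) by abel, smul_sub, smul_smul,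
        inv_mul_cancel₀ ht.ne', one_smul]
      abel
    rw [dist_eq_norm, this, norm_smul, norm_inv, Real.norm_of_nonneg ht.le, inv_mul_lt_iff₀ ht]
    nlinarith
  rw [Prod.dist_eq]
  refine max_lt ?_ h8
  rw [Metric.mem_ball, dist_comm] at ht1
  exact ht1

/-- Limiting normals to a locally closed set are the limits of regular normals. -/
theorem mem_normalCone_iff_closure [ProperSpace X] {Ω : Set X} {x v : X} (hΩ : ClosedNear Ω x) :
    v ∈ normalCone Ω x ↔
      x ∈ Ω ∧ (x, v) ∈ closure {p : X × X | p.2 ∈ regularNormalCone Ω p.1} := by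
  constructor
  · rintro ⟨hx, xs, ws, α, h1, h2, h3, h4⟩
    refine ⟨hx, mem_closure_of_tendsto (f := fun k => (ws k, α k • (xs k - ws k)))
      (Tendsto.prodMk_nhds ?_ h4)
      (Eventually.of_forall fun k => smul_sub_mem_regularNormalCone (h2 k) (h3 k))⟩
    rw [tendsto_iff_dist_tendsto_zero] at h1 ⊢
    refine squeeze_zero (fun _ => dist_nonneg) (fun k => ?_) (by simpa using h1.const_mul 2)
    have h5 : dist (xs k) (ws k) ≤ dist (xs k) x := by
      rw [(h2 k).2]; exact Metric.infDist_le_dist_of_mem hx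
    have h6 := dist_triangle_left (ws k) x (xs k)
    linarith
  · rintro ⟨hx, hcl⟩
    rw [mem_normalCone_iff_closure_proximalPairs]
    refine ⟨hx, ?_⟩
    -- Idempotence of closure replaces the choice of a diagonal sequence.
    rw [← closure_closure, mem_closure_iff_frequently]
    rw [mem_closure_iff_frequently] at hcl
    have h1 : ∀ᶠ p : X × X in 𝓝 (x, v), ClosedNear Ω p.1 :=
      (continuous_fst.tendsto (x, v)).eventually hΩ.eventually
    exact (hcl.and_eventually h1).mono fun p hp =>
      regularNormal_mem_closure_proximalPairs hp.1 hp.2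

/-- The graph of the normal cone mapping is locally closed where the set is. -/
theorem closedNear_gph_normalCone {Ω : Set X} {x v : X} (hΩ : ClosedNear Ω x) :
    ClosedNear (gph (normalCone Ω)) (WithLp.toLp 2 (x, v)) := by
  obtain ⟨U, hU, hc⟩ := hΩ
  refine ⟨WithLp.fst ⁻¹' U, (by fun_prop : Continuous fun p : WithLp 2 (X × X) => p.fst).tendsto
    (WithLp.toLp 2 (x, v)) hU, ?_⟩
  have : gph (normalCone Ω) ∩ WithLp.fst ⁻¹' U =
      (fun p : WithLp 2 (X × X) => p.fst) ⁻¹' (Ω ∩ U) ∩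
        (fun p : WithLp 2 (X × X) => (p.fst, p.snd)) ⁻¹' closure (proximalPairs Ω) := by
    ext p
    change p.snd ∈ normalCone Ω p.fst ∧ p.fst ∈ U ↔
      (p.fst ∈ Ω ∧ p.fst ∈ U) ∧ (p.fst, p.snd) ∈ closure (proximalPairs Ω)
    rw [mem_normalCone_iff_closure_proximalPairs]
    tauto
  rw [this]
  exact (hc.preimage (by fun_prop)).inter (isClosed_closure.preimage (by fun_prop))

/-- Regular normals pull back along differentiable maps. -/
theorem regularNormalCone_comap {Y : Type*} [NormedAddCommGroup Y] [InnerProductSpace ℝ Y]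
    {S : Set X} {Ω : Set Y} {Φ : X → Y} {A : X →L[ℝ] Y} {x : X} {v : Y} {ξ : X}
    (hΦ : HasFDerivAt Φ A x) (hS : ∀ᶠ x' in 𝓝 x, x' ∈ S → Φ x' ∈ Ω) (hx : x ∈ S)
    (hv : v ∈ regularNormalCone Ω (Φ x)) (hξ : ∀ k, inner ℝ ξ k = inner ℝ v (A k)) :
    ξ ∈ regularNormalCone S x := by
  refine ⟨hx, fun ε hε => ?_⟩
  obtain ⟨C, hC, hO⟩ := hΦ.isBigO_sub.exists_pos
  have h1 := hΦ.continuousAt.eventually (hv.2 (ε / (2 * C)) (by positivity))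
  -- Half of `ε` pays for the linearization error, half for the regular-normal estimate; `‖v‖ + 1`
  -- avoids dividing by zero.
  have h2 := hΦ.isLittleO.def (show 0 < ε / (2 * (‖v‖ + 1)) by positivity)
  filter_upwards [hO.bound, h1, h2, hS] with y hy1 hy2 hy3 hy4 hyS
  have h3 := hy2 (hy4 hyS)
  rw [hξ, show A (y - x) = (Φ y - Φ x) - (Φ y - Φ x - A (y - x)) by abel, inner_sub_right]
  have h4 := neg_le_of_abs_le (abs_real_inner_le_norm v (Φ y - Φ x - A (y - x)))
  have h5 : ‖v‖ * ‖Φ y - Φ x - A (y - x)‖ ≤ ε / 2 * ‖y - x‖ := by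
    calc _ ≤ (‖v‖ + 1) * (ε / (2 * (‖v‖ + 1)) * ‖y - x‖) := by gcongr; linarith
      _ = _ := by field_simp
  have h6 : ε / (2 * C) * ‖Φ y - Φ x‖ ≤ ε / 2 * ‖y - x‖ := by
    calc _ ≤ ε / (2 * C) * (C * ‖y - x‖) := by gcongr
      _ = _ := by field_simp
  linarith

/-- A regular normal has nonpositive product with every direction in which a ray stays in
the set. -/
theorem inner_nonpos_of_ray {Ω : Set X} {w v k : X} (hv : v ∈ regularNormalCone Ω w)
    (hk : ∀ᶠ t : ℝ in 𝓝[>] 0, w + t • k ∈ Ω) : inner ℝ v k ≤ 0 := by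
  by_contra! h
  have hk0 : 0 < ‖k‖ := by
    rw [norm_pos_iff]; rintro rfl; simp at h
  have hlim : Tendsto (fun t : ℝ => w + t • k) (𝓝[>] 0) (𝓝 w) := by
    have : Tendsto (fun t : ℝ => w + t • k) (𝓝 0) (𝓝 (w + (0 : ℝ) • k)) :=
      (by fun_prop : Continuous fun t : ℝ => w + t • k).tendsto 0
    rw [zero_smul, add_zero] at this
    exact this.mono_left nhdsWithin_le_nhds
  obtain ⟨t, ⟨h1, h2⟩, ht⟩ := ((hk.and (hlim.eventually
    (hv.2 (inner ℝ v k / (2 * ‖k‖)) (by positivity)))).and self_mem_nhdsWithin).exists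
  have ht : 0 < t := ht
  have h3 := h2 h1
  rw [add_sub_cancel_left, real_inner_smul_right, norm_smul, Real.norm_of_nonneg ht.le] at h3
  have h4 : inner ℝ v k / (2 * ‖k‖) * (t * ‖k‖) = t * inner ℝ v k / 2 := by field_simp
  have h5 : 0 < t * inner ℝ v k := by positivity
  linarith

end RegularNormals

/-! ### Normal cones to preimages under submersions -/

section PreimageRule

theorem tendsto_clm_apply {ι X Y : Type*} [NormedAddCommGroup X] [NormedSpace ℝ X]
    [NormedAddCommGroup Y] [NormedSpace ℝ Y] {l : Filter ι} {A : ι → X →L[ℝ] Y} {x : ι → X}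
    {B : X →L[ℝ] Y} {y : X} (hA : Tendsto A l (𝓝 B)) (hx : Tendsto x l (𝓝 y)) :
    Tendsto (fun i => A i (x i)) l (𝓝 (B y)) :=
  (isBoundedBilinearMap_apply.continuous.tendsto (B, y)).comp (hA.prodMk_nhds hx)

theorem tendsto_clm_comp {ι X Y Z : Type*} [NormedAddCommGroup X] [NormedSpace ℝ X]
    [NormedAddCommGroup Y] [NormedSpace ℝ Y] [NormedAddCommGroup Z] [NormedSpace ℝ Z]
    {l : Filter ι} {A : ι → Y →L[ℝ] Z} {B : ι → X →L[ℝ] Y} {A' : Y →L[ℝ] Z} {B' : X →L[ℝ] Y}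
    (hA : Tendsto A l (𝓝 A')) (hB : Tendsto B l (𝓝 B')) :
    Tendsto (fun i => (A i).comp (B i)) l (𝓝 (A'.comp B')) :=
  (isBoundedBilinearMap_comp.continuous.tendsto (A', B')).comp (hA.prodMk_nhds hB)

/-- The map `y ↦ Φ (x + R y)` has derivative `A R = id` at `0`; follow its local inverse by `y ↦ x +
R y`. -/
theorem _root_.HasStrictFDerivAt.exists_local_section {X Y : Type*}
    [NormedAddCommGroup X] [InnerProductSpace ℝ X] [CompleteSpace X] [NormedAddCommGroup Y]
    [InnerProductSpace ℝ Y] [FiniteDimensional ℝ Y] {Φ : X → Y}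
    {A : X →L[ℝ] Y} {x : X} (hΦ : HasStrictFDerivAt Φ A x) {R : Y →L[ℝ] X} (hR : ∀ y, A (R y) = y) :
    ∃ ψ : Y → X, ψ (Φ x) = x ∧ HasFDerivAt ψ R (Φ x) ∧ ∀ᶠ y in 𝓝 (Φ x), Φ (ψ y) = y := by
  have : CompleteSpace Y := FiniteDimensional.complete ℝ Y
  have hin : HasStrictFDerivAt (fun y : Y => x + R y) R 0 :=
    R.hasStrictFDerivAt.const_add x
  have h0 : x + R 0 = x := by simp
  have hF : HasStrictFDerivAt (fun y : Y => Φ (x + R y))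
      ((ContinuousLinearEquiv.refl ℝ Y : Y ≃L[ℝ] Y) : Y →L[ℝ] Y) 0 := by
    have h1 : HasStrictFDerivAt Φ A (x + R 0) := by rwa [h0]
    convert h1.comp (0 : Y) hin using 1
    ext y; simp [hR]
  have hinv := hF.to_localInverse
  have hright := hF.eventually_right_inverse
  have hself := hF.localInverse_apply_image
  simp only [map_zero, add_zero] at hinv hright hself
  refine ⟨fun y => x + R (hF.localInverse _ _ _ y), by simp [hself], ?_, hright⟩
  have h2 := (R.hasStrictFDerivAt.comp (Φ x) hinv).hasFDerivAt.const_add x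
  convert h2 using 1
  ext y; rfl

variable {X Y : Type*} [NormedAddCommGroup X] [InnerProductSpace ℝ X] [FiniteDimensional ℝ X]
  [NormedAddCommGroup Y] [InnerProductSpace ℝ Y] [FiniteDimensional ℝ Y]

/-- Membership in `S` depends only on `Φ` near `x`, so the whole fibre of `Φ` through `x` lies
locally in `S`. It is tangent to `ker A`, and a regular normal is nonpositive on both `k` and `-k`.
-/
theorem inner_ker_eq_zero {S : Set X} {Ω : Set Y} {Φ : X → Y} {A : X →L[ℝ] Y} {x ξ : X}
    (hΦ : HasStrictFDerivAt Φ A x) (hA : Function.Surjective A)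
    (hS : ∀ᶠ x' in 𝓝 x, x' ∈ S ↔ Φ x' ∈ Ω) (hξ : ξ ∈ regularNormalCone S x) {k : X}
    (hk : A k = 0) : inner ℝ ξ k = 0 := by
  have : CompleteSpace X := FiniteDimensional.complete ℝ X
  have : CompleteSpace Y := FiniteDimensional.complete ℝ Y
  have hr : A.range = ⊤ := LinearMap.range_eq_top.2 hA
  let c := hΦ.implicitFunction Φ A hr (Φ x)
  have hc : HasStrictFDerivAt c A.ker.subtypeL 0 := hΦ.to_implicitFunction hr
  have hc0 : c 0 = x := by
    simp [c]
  have hΦc : ∀ᶠ q in 𝓝 (0 : A.ker), Φ (c q) = Φ x := by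
    have h1 := hΦ.map_implicitFunction_eq hr
    have h2 : Tendsto (fun q : A.ker => (Φ x, q)) (𝓝 0) (𝓝 (Φ x, 0)) :=
      (by fun_prop : Continuous fun q : A.ker => (Φ x, q)).tendsto 0
    exact h2.eventually h1
  have hmem : ∀ᶠ q in 𝓝 (0 : A.ker), q ∈ (Set.univ : Set A.ker) → c q ∈ S := by
    have h3 : Tendsto c (𝓝 0) (𝓝 x) := by
      have := hc.hasFDerivAt.continuousAt.tendsto
      rwa [hc0] at this
    filter_upwards [hΦc, h3.eventually hS] with q hq1 hq2 _
    rw [hq2, hq1]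
    exact hS.self_of_nhds.1 hξ.1
  -- Pulled back along the fibre parametrization, `ξ` becomes a regular normal to the full space
  -- `ker A`.
  have hreg := regularNormalCone_comap (v := ξ)
    (ξ := ContinuousLinearMap.adjoint A.ker.subtypeL ξ) hc.hasFDerivAt hmem
    (Set.mem_univ _) (by rwa [hc0]) (fun q => ContinuousLinearMap.adjoint_inner_left _ _ _)
  have key : ∀ q : A.ker, inner ℝ ξ (q : X) ≤ 0 := fun q => by
    have := inner_nonpos_of_ray (k := q) hreg (Eventually.of_forall fun _ => Set.mem_univ _)
    rwa [ContinuousLinearMap.adjoint_inner_left] at this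
  have h1 := key ⟨k, hk⟩
  have h2 := key (-⟨k, hk⟩)
  simp only [Submodule.coe_neg, inner_neg_right] at h1 h2
  linarith

/-- Pulling `ξ` back along a local section with derivative `R` gives a regular normal `R^* ξ` to
`Ω`. Since `k - R (A k)` lies in `ker A`, where `ξ` vanishes, `ξ = A^* R^* ξ`. -/
theorem adjoint_section_mem_regularNormalCone {S : Set X} {Ω : Set Y} {Φ : X → Y}
    {A : X →L[ℝ] Y} {x ξ : X} (hΦ : HasStrictFDerivAt Φ A x) {R : Y →L[ℝ] X}
    (hR : ∀ y, A (R y) = y) (hS : ∀ᶠ x' in 𝓝 x, x' ∈ S ↔ Φ x' ∈ Ω)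
    (hξ : ξ ∈ regularNormalCone S x) :
    haveI := FiniteDimensional.complete ℝ X
    haveI := FiniteDimensional.complete ℝ Y
    ContinuousLinearMap.adjoint R ξ ∈ regularNormalCone Ω (Φ x) ∧
      ∀ k, inner ℝ ξ k = inner ℝ (ContinuousLinearMap.adjoint R ξ) (A k) := by
  have := FiniteDimensional.complete ℝ X
  have := FiniteDimensional.complete ℝ Y
  constructor
  · obtain ⟨ψ, hψ0, hψ, hΦψ⟩ := hΦ.exists_local_section hR
    have hc : Tendsto ψ (𝓝 (Φ x)) (𝓝 x) := by
      have := hψ.continuousAt.tendsto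
      rwa [hψ0] at this
    refine regularNormalCone_comap hψ (Ω := S) (v := ξ) ?_ (hS.self_of_nhds.1 hξ.1)
      (by rwa [hψ0]) (fun q => ContinuousLinearMap.adjoint_inner_left _ _ _)
    filter_upwards [hΦψ, hc.eventually hS] with y hy1 hy2 hy
    rw [hy2, hy1]
    exact hy
  · intro k
    rw [ContinuousLinearMap.adjoint_inner_left]
    have h := inner_ker_eq_zero hΦ (fun y => ⟨R y, hR y⟩) hS hξ (k := k - R (A k))
      (by rw [map_sub, hR, sub_self])
    rw [inner_sub_right] at h
    linarith

/-- The limiting normal cone to a preimage under a map with surjective derivative. -/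
theorem mem_normalCone_preimage_iff {S : Set X} {Ω : Set Y} {Φ : X → Y} {A : X →L[ℝ] Y}
    {x ξ : X} (hΦ : ContDiffAt ℝ 1 Φ x) (hA : HasFDerivAt Φ A x) (hsurj : Function.Surjective A)
    (hΩ : ClosedNear Ω (Φ x)) (hS : ∀ᶠ x' in 𝓝 x, x' ∈ S ↔ Φ x' ∈ Ω) :
    ξ ∈ normalCone S x ↔ ∃ v ∈ normalCone Ω (Φ x), ∀ k, inner ℝ ξ k = inner ℝ v (A k) := by
  have := FiniteDimensional.complete ℝ X
  have := FiniteDimensional.complete ℝ Y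
  have hA' : fderiv ℝ Φ x = A := hA.fderiv
  have hC1 : ∀ᶠ x' in 𝓝 x, ContDiffAt ℝ 1 Φ x' := hΦ.eventually (by simp)
  have hstrict : ∀ᶠ x' in 𝓝 x, HasStrictFDerivAt Φ (fderiv ℝ Φ x') x' :=
    hC1.mono fun x' h => h.hasStrictFDerivAt (by simp)
  have hcont : Tendsto (fderiv ℝ Φ) (𝓝 x) (𝓝 A) := by
    have := (hΦ.fderiv_right (m := 0) (by simp)).continuousAt.tendsto
    rwa [hA'] at this
  have hSclosed : ClosedNear S x := hΩ.preimage (hC1.mono fun _ h => h.continuousAt) hS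
  obtain ⟨R, hR⟩ := A.exists_rightInverse_of_surjective (LinearMap.range_eq_top.2 hsurj)
  have hR' : ∀ y, A (R y) = y := fun y => by
    have := DFunLike.congr_fun hR y
    simpa using this
  have hSS := eventually_eventually_nhds.2 hS
  rw [mem_normalCone_iff_closure hSclosed]
  simp_rw [mem_normalCone_iff_closure hΩ]
  constructor
  · rintro ⟨hx, hcl⟩
    obtain ⟨p, hp, hlim⟩ := mem_closure_iff_seq_limit.1 hcl
    have hp1 : Tendsto (fun k => (p k).1) atTop (𝓝 x) := (continuous_fst.tendsto _).comp hlim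
    have hp2 : Tendsto (fun k => (p k).2) atTop (𝓝 ξ) := (continuous_snd.tendsto _).comp hlim
    -- Since `M x' → A R = 1`, it is invertible near `x`, and `N x' = R (M x')⁻¹` is a right inverse
    -- of the derivative at `x'` converging to `R`. This lets the regular case at nearby points pass
    -- to the limit.
    let M : X → (Y →L[ℝ] Y) := fun x' => (fderiv ℝ Φ x').comp R
    have hM : Tendsto M (𝓝 x) (𝓝 1) := by
      have : Tendsto M (𝓝 x) (𝓝 (A.comp R)) := tendsto_clm_comp hcont tendsto_const_nhds
      rwa [hR] at this
    have hinv : Tendsto (fun x' => Ring.inverse (M x')) (𝓝 x) (𝓝 1) := by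
      have h1 := (NormedRing.inverse_continuousAt (1 : (Y →L[ℝ] Y)ˣ)).tendsto
      simp only [Units.val_one, Ring.inverse_one] at h1
      exact h1.comp hM
    have hunit : ∀ᶠ x' in 𝓝 x, IsUnit (M x') :=
      hM.eventually ((Units.isOpen (R := Y →L[ℝ] Y)).mem_nhds isUnit_one)
    let N : X → (Y →L[ℝ] X) := fun x' => R.comp (Ring.inverse (M x'))
    have hN : Tendsto N (𝓝 x) (𝓝 R) := by
      have : Tendsto N (𝓝 x) (𝓝 (R.comp (1 : Y →L[ℝ] Y))) :=
        tendsto_clm_comp tendsto_const_nhds hinv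
      exact this
    have hNr : ∀ᶠ x' in 𝓝 x, ∀ y, fderiv ℝ Φ x' (N x' y) = y := by
      filter_upwards [hunit] with x' hx' y
      exact DFunLike.congr_fun (Ring.mul_inverse_cancel _ hx') y
    have hadj : Tendsto (fun k => ContinuousLinearMap.adjoint (N (p k).1) (p k).2) atTop
        (𝓝 (ContinuousLinearMap.adjoint R ξ)) :=
      tendsto_clm_apply ((ContinuousLinearMap.adjoint.continuous.tendsto R).comp (hN.comp hp1)) hp2
    have hall := hp1.eventually (hstrict.and (hNr.and hSS))
    refine ⟨ContinuousLinearMap.adjoint R ξ, ⟨hS.self_of_nhds.1 hx, ?_⟩, ?_⟩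
    · refine mem_closure_of_tendsto ((hΦ.continuousAt.tendsto.comp hp1).prodMk_nhds hadj) ?_
      filter_upwards [hall] with k hk
      exact (adjoint_section_mem_regularNormalCone hk.1 hk.2.1 hk.2.2 (hp k)).1
    · intro q
      have h1 : Tendsto (fun k => inner ℝ (p k).2 q) atTop (𝓝 (inner ℝ ξ q)) :=
        hp2.inner tendsto_const_nhds
      have h2 : Tendsto (fun k => inner ℝ (ContinuousLinearMap.adjoint (N (p k).1) (p k).2)
          (fderiv ℝ Φ (p k).1 q)) atTop
          (𝓝 (inner ℝ (ContinuousLinearMap.adjoint R ξ) (A q))) :=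
        hadj.inner (tendsto_clm_apply (hcont.comp hp1) tendsto_const_nhds)
      refine tendsto_nhds_unique h1 (h2.congr' ?_)
      filter_upwards [hall] with k hk
      exact ((adjoint_section_mem_regularNormalCone hk.1 hk.2.1 hk.2.2 (hp k)).2 q).symm
  · rintro ⟨v, ⟨hx, hcl⟩, hv⟩
    obtain ⟨p, hp, hlim⟩ := mem_closure_iff_seq_limit.1 hcl
    have hp1 : Tendsto (fun k => (p k).1) atTop (𝓝 (Φ x)) :=
      (continuous_fst.tendsto _).comp hlim
    have hp2 : Tendsto (fun k => (p k).2) atTop (𝓝 v) := (continuous_snd.tendsto _).comp hlim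
    have hstrict0 : HasStrictFDerivAt Φ A x := by
      have := hstrict.self_of_nhds
      rwa [hA'] at this
    -- Base points are lifted by the section `ψ`, normals by the adjoint of the derivative at the
    -- lifted point.
    obtain ⟨ψ, hψ0, hψ, hΦψ⟩ := hstrict0.exists_local_section hR'
    have hψc : Tendsto ψ (𝓝 (Φ x)) (𝓝 x) := by
      have := hψ.continuousAt.tendsto
      rwa [hψ0] at this
    have hx1 : Tendsto (fun k => ψ (p k).1) atTop (𝓝 x) := hψc.comp hp1
    have hξ : ContinuousLinearMap.adjoint A v = ξ := by
      refine ext_inner_right ℝ fun q => ?_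
      rw [ContinuousLinearMap.adjoint_inner_left, hv]
    have hadj : Tendsto (fun k => ContinuousLinearMap.adjoint (fderiv ℝ Φ (ψ (p k).1)) (p k).2)
        atTop (𝓝 ξ) := by
      rw [← hξ]
      exact tendsto_clm_apply ((ContinuousLinearMap.adjoint.continuous.tendsto A).comp
        (hcont.comp hx1)) hp2
    refine ⟨hS.self_of_nhds.2 hx, mem_closure_of_tendsto (hx1.prodMk_nhds hadj) ?_⟩
    filter_upwards [hx1.eventually (hstrict.and hSS), hp1.eventually hΦψ] with k hk hk2
    have hpk : (p k).2 ∈ regularNormalCone Ω (Φ (ψ (p k).1)) := by rw [hk2]; exact hp k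
    exact regularNormalCone_comap hk.1.hasFDerivAt (hk.2.mono fun _ h => h.1)
      (hk.2.self_of_nhds.2 hpk.1) hpk fun q => ContinuousLinearMap.adjoint_inner_left _ _ _

end PreimageRule

/-! ### Normals to the orthant and to the complementarity set -/

section Complementarity

variable {s : ℕ}

/-- The nonnegative orthant. -/
def orthant (s : ℕ) : Set (E s) := {q | ∀ i, 0 ≤ q i}

/-- The complementarity relation `0 ≤ q ⊥ μ ≤ 0`. -/
def Complementary (q μ : E s) : Prop := ∀ i, 0 ≤ q i ∧ μ i ≤ 0 ∧ μ i * q i = 0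

theorem isClosed_orthant : IsClosed (orthant s) := by
  simp only [orthant, Set.ofPred_forall]
  exact isClosed_iInter fun i => isClosed_le continuous_const (by fun_prop)

theorem isClosed_complementary : IsClosed {p : E s × E s | Complementary p.1 p.2} := by
  simp only [Complementary, Set.ofPred_forall]
  refine isClosed_iInter fun i => ?_
  have h1 : Continuous fun p : E s × E s => p.1 i := by fun_prop
  have h2 : Continuous fun p : E s × E s => p.2 i := by fun_prop
  exact (isClosed_le continuous_const h1).inter
    ((isClosed_le h2 continuous_const).inter (isClosed_eq (h2.mul h1) continuous_const))

theorem inner_eq_sum (v z : E s) : inner ℝ v z = ∑ i, v i * z i := by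
  simp [PiLp.inner_apply, mul_comm]

theorem inner_single (v : E s) (i : Fin s) (c : ℝ) :
    inner ℝ v (EuclideanSpace.single i c) = v i * c := by
  simp [EuclideanSpace.inner_single_right, mul_comm]

theorem add_smul_single_apply (q : E s) (i j : Fin s) (t c : ℝ) :
    (q + t • EuclideanSpace.single i c) j = q j + (if j = i then t * c else 0) := by
  simp

theorem eventually_ray_nonneg {c : ℝ} (d : ℝ) (hc : 0 < c) :
    ∀ᶠ t : ℝ in 𝓝[>] 0, 0 ≤ c + t * d := by
  have h : Tendsto (fun t : ℝ => c + t * d) (𝓝 0) (𝓝 (c + 0 * d)) :=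
    (by fun_prop : Continuous fun t : ℝ => c + t * d).tendsto 0
  rw [zero_mul, add_zero] at h
  exact (h.mono_left nhdsWithin_le_nhds).eventually (le_mem_nhds hc)

theorem mem_regularNormalCone_orthant {q μ : E s} :
    μ ∈ regularNormalCone (orthant s) q ↔ Complementary q μ := by
  constructor
  · intro hμ i
    have hpos : ∀ᶠ t : ℝ in 𝓝[>] 0, q + t • EuclideanSpace.single i (1 : ℝ) ∈ orthant s := by
      filter_upwards [self_mem_nhdsWithin] with t ht j
      have ht : 0 < t := ht
      rw [add_smul_single_apply]
      have := hμ.1 j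
      split_ifs <;> linarith
    have h1 := inner_nonpos_of_ray hμ hpos
    rw [inner_single, mul_one] at h1
    refine ⟨hμ.1 i, h1, ?_⟩
    rcases (hμ.1 i).eq_or_lt with h | h
    · rw [← h, mul_zero]
    · have hneg : ∀ᶠ t : ℝ in 𝓝[>] 0, q + t • EuclideanSpace.single i (-1 : ℝ) ∈ orthant s := by
        filter_upwards [eventually_ray_nonneg (-1) h] with t ht j
        rw [add_smul_single_apply]
        have := hμ.1 j
        split_ifs with hj
        · rw [hj]; exact ht
        · linarith
      have h2 := inner_nonpos_of_ray hμ hneg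
      rw [inner_single] at h2
      rw [show μ i = 0 by linarith, zero_mul]
  · intro h
    refine ⟨fun i => (h i).1, fun ε hε => Eventually.of_forall fun y hy => ?_⟩
    refine le_trans ?_ (by positivity : 0 ≤ ε * ‖y - q‖)
    rw [inner_eq_sum]
    refine Finset.sum_nonpos fun i _ => ?_
    obtain ⟨-, h2, h3⟩ := h i
    have h4 : μ i * y i ≤ 0 := mul_nonpos_of_nonpos_of_nonneg h2 (hy i)
    rw [PiLp.sub_apply, mul_sub, h3]
    linarith

/-- Regular normals to the orthant already have a closed graph, so taking limits adds nothing. -/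
theorem mem_normalCone_orthant {q μ : E s} :
    μ ∈ normalCone (orthant s) q ↔ Complementary q μ := by
  rw [mem_normalCone_iff_closure ⟨Set.univ, univ_mem, by simpa using isClosed_orthant⟩]
  have : {p : E s × E s | p.2 ∈ regularNormalCone (orthant s) p.1} =
      {p | Complementary p.1 p.2} := by
    ext p; exact mem_regularNormalCone_orthant
  rw [this, isClosed_complementary.closure_eq]
  exact ⟨fun h => h.2, fun h => ⟨fun i => (h i).1, h⟩⟩

/-- The triples `(q, μ, 0)` with `q` and `μ` complementary. -/
def complementaritySet (s : ℕ) (K : Type*) [Zero K] : Set (WithLp 2 (E s × WithLp 2 (E s × K))) :=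
  {p | Complementary p.fst p.snd.fst ∧ p.snd.snd = 0}

theorem isClosed_complementaritySet {K : Type*} [NormedAddCommGroup K] : IsClosed (complementaritySet s K) :=
  (isClosed_complementary.preimage (by fun_prop :
    Continuous fun p : WithLp 2 (E s × WithLp 2 (E s × K)) => (p.fst, p.snd.fst))).inter
    (isClosed_eq (by fun_prop) continuous_const)

variable {K : Type*} [NormedAddCommGroup K] [InnerProductSpace ℝ K]

theorem inner_triple (α β : E s) (γ : K) (p : WithLp 2 (E s × WithLp 2 (E s × K))) :
    inner ℝ (WithLp.toLp 2 (α, WithLp.toLp 2 (β, γ))) p =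
      inner ℝ α p.fst + (inner ℝ β p.snd.fst + inner ℝ γ p.snd.snd) := by
  simp [WithLp.prod_inner_apply]

/-- Strict inequalities persist nearby: where `q i > 0` or `μ i < 0`, the partner coordinate stays
zero. Where both vanish, the signs suffice. Each summand is thus nonpositive, with no error term;
`γ` is free because the last coordinate is constant. -/
theorem regularNormal_complementaritySet_of {q μ α β : E s} {γ : K} (hq : Complementary q μ)
    (h : ∀ i, (0 < q i → α i = 0) ∧ (μ i < 0 → β i = 0) ∧
      (q i = 0 → μ i = 0 → α i ≤ 0 ∧ 0 ≤ β i)) :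
    WithLp.toLp 2 (α, WithLp.toLp 2 (β, γ)) ∈
      regularNormalCone (complementaritySet s K) (WithLp.toLp 2 (q, WithLp.toLp 2 (μ, 0))) := by
  refine ⟨⟨hq, rfl⟩, fun ε hε => ?_⟩
  have hnear : ∀ᶠ y : WithLp 2 (E s × WithLp 2 (E s × K)) in
      𝓝 (WithLp.toLp 2 (q, WithLp.toLp 2 (μ, 0))),
      ∀ i, (0 < q i → 0 < y.fst i) ∧ (μ i < 0 → y.snd.fst i < 0) := by
    refine eventually_all.2 fun i => Eventually.and ?_ ?_
    · by_cases hi : 0 < q i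
      · have := ((by fun_prop : Continuous fun y : WithLp 2 (E s × WithLp 2 (E s × K)) =>
          y.fst i).tendsto (WithLp.toLp 2 (q, WithLp.toLp 2 (μ, 0)))).eventually (lt_mem_nhds hi)
        exact this.mono fun y hy _ => hy
      · exact Eventually.of_forall fun _ h => absurd h hi
    · by_cases hi : μ i < 0
      · have := ((by fun_prop : Continuous fun y : WithLp 2 (E s × WithLp 2 (E s × K)) =>
          y.snd.fst i).tendsto (WithLp.toLp 2 (q, WithLp.toLp 2 (μ, 0)))).eventually
          (gt_mem_nhds hi)
        exact this.mono fun y hy _ => hy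
      · exact Eventually.of_forall fun _ h => absurd h hi
  filter_upwards [hnear] with y hy hyΩ
  refine le_trans ?_ (by positivity : 0 ≤ ε * ‖y - WithLp.toLp 2 (q, WithLp.toLp 2 (μ, 0))‖)
  rw [inner_triple]
  have hz : (y - WithLp.toLp 2 (q, WithLp.toLp 2 (μ, (0 : K)))).snd.snd = 0 := by
    simp [hyΩ.2]
  rw [hz, inner_zero_right, add_zero, inner_eq_sum, inner_eq_sum, ← Finset.sum_add_distrib]
  refine Finset.sum_nonpos fun i _ => ?_
  change α i * (y.fst i - q i) + β i * (y.snd.fst i - μ i) ≤ 0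
  obtain ⟨hq1, hq2, hq3⟩ := hq i
  obtain ⟨hy1, hy2, hy3⟩ := hyΩ.1 i
  obtain ⟨h1, h2, h3⟩ := h i
  obtain ⟨n1, n2⟩ := hy i
  rcases hq1.eq_or_lt with h0 | h0
  · rcases hq2.eq_or_lt with h0' | h0'
    · obtain ⟨h4, h5⟩ := h3 h0.symm h0'
      rw [← h0, h0', sub_zero, sub_zero]
      nlinarith
    · have h6 : y.fst i = 0 := (mul_eq_zero.1 hy3).resolve_left (n2 h0').ne
      rw [h2 h0', h6, ← h0]; simp
  · have h6 : y.snd.fst i = 0 := (mul_eq_zero.1 hy3).resolve_right (n1 h0).ne'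
    have h7 : μ i = 0 := (mul_eq_zero.1 hq3).resolve_right h0.ne'
    rw [h1 h0, h6, h7]; simp

/-- If one coordinate of the `i`-th pair is zero, the other may move along its axis while it keeps
its sign: both ways when nonzero, one way when zero. -/
theorem regularNormal_complementaritySet_imp {p v : WithLp 2 (E s × WithLp 2 (E s × K))}
    (hv : v ∈ regularNormalCone (complementaritySet s K) p) (i : Fin s) :
    (0 < p.fst i → v.fst i = 0) ∧ (p.snd.fst i < 0 → v.snd.fst i = 0) ∧
      (p.fst i = 0 → p.snd.fst i = 0 → v.fst i ≤ 0 ∧ 0 ≤ v.snd.fst i) := by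
  obtain ⟨hp, hp0⟩ := hv.1
  have ray1 : ∀ c : ℝ, (∀ᶠ t : ℝ in 𝓝[>] 0, 0 ≤ p.fst i + t * c) → p.snd.fst i = 0 →
      v.fst i * c ≤ 0 := by
    intro c hc h0
    have := inner_nonpos_of_ray (k := WithLp.toLp 2 (EuclideanSpace.single i c, 0)) hv ?_
    · simpa [WithLp.prod_inner_apply, inner_single] using this
    · filter_upwards [hc] with t ht
      refine ⟨fun j => ?_, by simp [hp0]⟩
      have e1 : (p + t • WithLp.toLp 2 (EuclideanSpace.single i c,
          (0 : WithLp 2 (E s × K)))).fst j = p.fst j + (if j = i then t * c else 0) :=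
        add_smul_single_apply p.fst i j t c
      have e2 : (p + t • WithLp.toLp 2 (EuclideanSpace.single i c,
          (0 : WithLp 2 (E s × K)))).snd.fst j = p.snd.fst j := by simp
      rw [e1, e2]
      split_ifs with hj
      · rw [hj, h0]; exact ⟨ht, le_rfl, zero_mul _⟩
      · rw [add_zero]; exact hp j
  have ray2 : ∀ c : ℝ, (∀ᶠ t : ℝ in 𝓝[>] 0, 0 ≤ -p.snd.fst i + t * (-c)) → p.fst i = 0 →
      v.snd.fst i * c ≤ 0 := by
    intro c hc h0
    have := inner_nonpos_of_ray
      (k := WithLp.toLp 2 ((0 : E s), WithLp.toLp 2 (EuclideanSpace.single i c, (0 : K)))) hv ?_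
    · simpa [WithLp.prod_inner_apply, inner_single] using this
    · filter_upwards [hc] with t ht
      refine ⟨fun j => ?_, by simp [hp0]⟩
      have e1 : (p + t • WithLp.toLp 2 ((0 : E s), WithLp.toLp 2
          (EuclideanSpace.single i c, (0 : K)))).snd.fst j =
          p.snd.fst j + (if j = i then t * c else 0) :=
        add_smul_single_apply p.snd.fst i j t c
      have e2 : (p + t • WithLp.toLp 2 ((0 : E s), WithLp.toLp 2
          (EuclideanSpace.single i c, (0 : K)))).fst j = p.fst j := by simp
      rw [e1, e2]
      split_ifs with hj
      · rw [hj, h0]; exact ⟨le_rfl, by linarith, mul_zero _⟩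
      · rw [add_zero]; exact hp j
  have hge : ∀ c : ℝ, 0 ≤ c → ∀ᶠ t : ℝ in 𝓝[>] 0, 0 ≤ t * c := fun c hc => by
    filter_upwards [self_mem_nhdsWithin] with t ht
    exact mul_nonneg (le_of_lt ht) hc
  refine ⟨fun h => ?_, fun h => ?_, fun h1 h2 => ⟨?_, ?_⟩⟩
  · have h0 : p.snd.fst i = 0 := (mul_eq_zero.1 (hp i).2.2).resolve_right h.ne'
    have r1 := ray1 1 (eventually_ray_nonneg _ h) h0
    have r2 := ray1 (-1) (eventually_ray_nonneg _ h) h0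
    linarith
  · have h0 : p.fst i = 0 := (mul_eq_zero.1 (hp i).2.2).resolve_left h.ne
    have r1 := ray2 1 (eventually_ray_nonneg _ (by linarith)) h0
    have r2 := ray2 (-1) (eventually_ray_nonneg _ (by linarith)) h0
    linarith
  · have r1 := ray1 1 (by simpa [h1] using hge 1 zero_le_one) h2
    linarith
  · have r1 := ray2 (-1) (by simpa [h2] using hge 1 zero_le_one) h1
    linarith

/-- At an index with `q i = μ i = 0`, limits may also come from either adjacent branch, where one
component of the normal vanishes; this adds the alternatives `α i = 0` and `β i = 0`. -/
theorem mem_normalCone_complementaritySet [FiniteDimensional ℝ K] {q μ α β : E s} {γ : K} :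
    WithLp.toLp 2 (α, WithLp.toLp 2 (β, γ)) ∈
        normalCone (complementaritySet s K) (WithLp.toLp 2 (q, WithLp.toLp 2 (μ, 0))) ↔
      Complementary q μ ∧ ∀ i, (0 < q i → α i = 0) ∧ (μ i < 0 → β i = 0) ∧
        ((α i ≤ 0 ∧ 0 ≤ β i) ∨ α i = 0 ∨ β i = 0) := by
  rw [mem_normalCone_iff_closure
    ⟨Set.univ, univ_mem, by simpa using isClosed_complementaritySet⟩]
  constructor
  · rintro ⟨⟨hq, -⟩, hcl⟩
    refine ⟨hq, fun i => ?_⟩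
    obtain ⟨p, hp, hlim⟩ := mem_closure_iff_seq_limit.1 hcl
    have h1 : Tendsto (fun k => (p k).1.fst i) atTop (𝓝 (q i)) :=
      ((by fun_prop : Continuous fun y : WithLp 2 (E s × WithLp 2 (E s × K)) ×
        WithLp 2 (E s × WithLp 2 (E s × K)) => y.1.fst i).tendsto _).comp hlim
    have h2 : Tendsto (fun k => (p k).1.snd.fst i) atTop (𝓝 (μ i)) :=
      ((by fun_prop : Continuous fun y : WithLp 2 (E s × WithLp 2 (E s × K)) ×
        WithLp 2 (E s × WithLp 2 (E s × K)) => y.1.snd.fst i).tendsto _).comp hlim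
    have h3 : Tendsto (fun k => (p k).2.fst i) atTop (𝓝 (α i)) :=
      ((by fun_prop : Continuous fun y : WithLp 2 (E s × WithLp 2 (E s × K)) ×
        WithLp 2 (E s × WithLp 2 (E s × K)) => y.2.fst i).tendsto _).comp hlim
    have h4 : Tendsto (fun k => (p k).2.snd.fst i) atTop (𝓝 (β i)) :=
      ((by fun_prop : Continuous fun y : WithLp 2 (E s × WithLp 2 (E s × K)) ×
        WithLp 2 (E s × WithLp 2 (E s × K)) => y.2.snd.fst i).tendsto _).comp hlim
    have hreg := fun k => regularNormal_complementaritySet_imp (hp k) i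
    refine ⟨fun h => ?_, fun h => ?_, ?_⟩
    · refine tendsto_nhds_unique (h3.congr' ?_) tendsto_const_nhds
      exact (h1.eventually (lt_mem_nhds h)).mono fun k hk => (hreg k).1 hk
    · refine tendsto_nhds_unique (h4.congr' ?_) tendsto_const_nhds
      exact (h2.eventually (gt_mem_nhds h)).mono fun k hk => (hreg k).2.1 hk
    · have hclosed : IsClosed {x : ℝ × ℝ | (x.1 ≤ 0 ∧ 0 ≤ x.2) ∨ x.1 = 0 ∨ x.2 = 0} :=
        ((isClosed_le continuous_fst continuous_const).inter
          (isClosed_le continuous_const continuous_snd)).union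
          ((isClosed_eq continuous_fst continuous_const).union
            (isClosed_eq continuous_snd continuous_const))
      refine hclosed.mem_of_tendsto (h3.prodMk_nhds h4) (Eventually.of_forall fun k => ?_)
      obtain ⟨r1, r2, r3⟩ := hreg k
      obtain ⟨c1, c2, -⟩ := (hp k).1.1 i
      rcases c1.eq_or_lt with h0 | h0
      · rcases c2.eq_or_lt with h0' | h0'
        · exact Or.inl (r3 h0.symm h0')
        · exact Or.inr (Or.inr (r2 h0'))
      · exact Or.inr (Or.inl (r1 h0))
  · rintro ⟨hq, h⟩
    refine ⟨⟨hq, rfl⟩, ?_⟩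
    -- If `α i = 0` but `β i < 0`, move `q i` into the positive branch; if `β i = 0` but `α i > 0`,
    -- move `μ i` into the negative one. The given vector is then a regular normal at the shifted
    -- point. In the first case `h` forces `μ i = 0`, in the second `q i = 0`, so complementarity
    -- survives.
    let a : E s := WithLp.toLp 2 fun i => if α i = 0 ∧ β i < 0 then 1 else 0
    let b : E s := WithLp.toLp 2 fun i => if β i = 0 ∧ 0 < α i then 1 else 0
    have hlim : Tendsto (fun t : ℝ => ((WithLp.toLp 2 (q + t • a, WithLp.toLp 2
        (μ - t • b, 0)) : WithLp 2 (E s × WithLp 2 (E s × K))),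
        WithLp.toLp 2 (α, WithLp.toLp 2 (β, γ)))) (𝓝[>] 0)
        (𝓝 (WithLp.toLp 2 (q, WithLp.toLp 2 (μ, 0)),
          WithLp.toLp 2 (α, WithLp.toLp 2 (β, γ)))) := by
      refine Tendsto.mono_left ?_ nhdsWithin_le_nhds
      convert Continuous.tendsto (f := fun t : ℝ => ((WithLp.toLp 2 (q + t • a, WithLp.toLp 2
        (μ - t • b, 0)) : WithLp 2 (E s × WithLp 2 (E s × K))),
        (WithLp.toLp 2 (α, WithLp.toLp 2 (β, γ)) : WithLp 2 (E s × WithLp 2 (E s × K)))))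
        (by fun_prop) 0 using 3
      · simp
    refine mem_closure_of_tendsto hlim ?_
    filter_upwards [self_mem_nhdsWithin] with t ht
    have ht : 0 < t := ht
    have ea : ∀ i, (q + t • a) i = q i + (if α i = 0 ∧ β i < 0 then t else 0) := fun i => by
      simp [a]
    have eb : ∀ i, (μ - t • b) i = μ i - (if β i = 0 ∧ 0 < α i then t else 0) := fun i => by
      simp [b]
    apply regularNormal_complementaritySet_of
    · intro i
      rw [ea, eb]
      obtain ⟨c1, c2, c3⟩ := hq i
      obtain ⟨h1, h2, h3⟩ := h i
      split_ifs with ha hb hb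
      · exact absurd ha.1 hb.2.ne'
      · have : μ i = 0 := by
          by_contra h0
          exact ha.2.ne (h2 (lt_of_le_of_ne c2 h0))
        rw [this]
        exact ⟨by linarith, by simp, by simp⟩
      · have : q i = 0 := by
          by_contra h0
          exact hb.2.ne' (h1 (lt_of_le_of_ne c1 (Ne.symm h0)))
        rw [this]
        exact ⟨by simp, by linarith, by simp⟩
      · simpa using hq i
    · intro i
      rw [ea, eb]
      obtain ⟨c1, c2, c3⟩ := hq i
      obtain ⟨h1, h2, h3⟩ := h i
      split_ifs with ha hb hb
      · exact absurd ha.1 hb.2.ne'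
      · refine ⟨fun _ => ha.1, fun h' => h2 (by linarith), fun h' => ?_⟩
        linarith
      · refine ⟨fun h' => h1 (by linarith), fun _ => hb.1, fun _ h' => ?_⟩
        linarith
      · refine ⟨fun h' => h1 (by linarith), fun h' => h2 (by linarith), fun _ _ => ?_⟩
        rcases h3 with h3 | h3 | h3
        · exact h3
        · refine ⟨h3.le, ?_⟩
          by_contra! hlt
          exact ha ⟨h3, hlt⟩
        · refine ⟨?_, h3.ge⟩
          by_contra! hlt
          exact hb ⟨h3, hlt⟩

end Complementarity

/-! ### The graph of the normal cone mapping of a constraint set -/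

section ConstraintSystem

set_option synthInstance.maxHeartbeats 200000

variable {n s : ℕ} {g : E n → E s} {p x : E n}

theorem inner_jacT (μ : E s) (k : E n) :
    inner ℝ (jacT g x μ) k = inner ℝ μ (fderiv ℝ g x k) :=
  ContinuousLinearMap.adjoint_inner_left _ _ _

theorem hasFDerivAt_component (hg : DifferentiableAt ℝ g x) (i : Fin s) :
    HasFDerivAt (fun q => g q i) ((EuclideanSpace.proj i).comp (fderiv ℝ g x)) x :=
  (EuclideanSpace.proj i : E s →L[ℝ] ℝ).hasFDerivAt.comp x hg.hasFDerivAt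

theorem inner_grad (hg : DifferentiableAt ℝ g x) (i : Fin s) (k : E n) :
    inner ℝ (grad g i x) k = fderiv ℝ g x k i := by
  rw [grad, gradient, InnerProductSpace.toDual_symm_apply, (hasFDerivAt_component hg i).fderiv]
  rfl

theorem jacT_eq_sum (hg : DifferentiableAt ℝ g x) (μ : E s) :
    jacT g x μ = ∑ i, μ i • grad g i x := by
  refine ext_inner_right ℝ fun k => ?_
  rw [inner_jacT, inner_eq_sum, sum_inner]
  refine Finset.sum_congr rfl fun i _ => ?_
  rw [real_inner_smul_left, inner_grad hg]

theorem contDiffAt_grad (hg : ContDiffAt ℝ 2 g p) (i : Fin s) : ContDiffAt ℝ 1 (grad g i) p := by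
  rw [contDiffAt_piLp]
  intro j
  have h1 : ContDiffAt ℝ 1 (fderiv ℝ g) p := hg.fderiv_right (by norm_num)
  have h2 : ContDiffAt ℝ 1 (fun x => fderiv ℝ g x (EuclideanSpace.single j 1)) p :=
    h1.clm_apply contDiffAt_const
  have h3 : ContDiffAt ℝ 1 (fun x => fderiv ℝ g x (EuclideanSpace.single j 1) i) p :=
    (contDiffAt_piLp 2).1 h2 i
  refine h3.congr_of_eventuallyEq ?_
  filter_upwards [hg.eventually (by simp)] with x hx
  rw [← inner_grad (hx.differentiableAt (by simp)), inner_single, mul_one]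

theorem hasFDerivAt_grad (hg : ContDiffAt ℝ 2 g p) (i : Fin s) :
    HasFDerivAt (grad g i) (hess g i p) p :=
  ((contDiffAt_grad hg i).differentiableAt (by simp)).hasFDerivAt

/-- The Riesz isomorphism turns `hess` into the second derivative of `g_i`, which is symmetric for a
C² function. This is what computes the adjoint of the derivative of `normalParam`. -/
theorem inner_hess_comm (hg : ContDiffAt ℝ 2 g p) (i : Fin s) (ξ η : E n) :
    inner ℝ (hess g i p ξ) η = inner ℝ ξ (hess g i p η) := by
  have hgi : ContDiffAt ℝ 2 (fun q => g q i) p := (contDiffAt_piLp 2).1 hg i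
  have hsymm : IsSymmSndFDerivAt ℝ (fun q => g q i) p :=
    hgi.isSymmSndFDerivAt (by simp)
  have key : ∀ a b : E n, inner ℝ (hess g i p a) b =
      fderiv ℝ (fderiv ℝ (fun q => g q i)) p a b := by
    intro a b
    have h1 : HasFDerivAt (fun x => inner ℝ (grad g i x) b)
        ((innerSL ℝ b).comp (hess g i p)) p := by
      have := (innerSL ℝ b).hasFDerivAt.comp p (hasFDerivAt_grad hg i)
      refine this.congr_of_eventuallyEq (Eventually.of_forall fun x => ?_)
      exact (real_inner_comm _ _)
    have h2 : HasFDerivAt (fun x => fderiv ℝ (fun q => g q i) x b)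
        ((fderiv ℝ (fderiv ℝ (fun q => g q i)) p).flip b) p := by
      have h3 : ContDiffAt ℝ 1 (fderiv ℝ (fun q => g q i)) p := hgi.fderiv_right (by norm_num)
      have h4 := (h3.differentiableAt (by simp)).hasFDerivAt.clm_apply (hasFDerivAt_const b p)
      refine h4.congr_fderiv ?_
      ext; simp
    have h5 := DFunLike.congr_fun (h1.unique (h2.congr_of_eventuallyEq
      (Eventually.of_forall fun x => ?_))) a
    · rw [real_inner_comm]; exact h5
    · change inner ℝ (gradient (fun q => g q i) x) b = _
      rw [gradient, InnerProductSpace.toDual_symm_apply]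
  rw [key, hsymm, ← key, real_inner_comm]

theorem jacT_injective (h : Function.Surjective (fderiv ℝ g p)) :
    Function.Injective (jacT g p) := by
  refine (injective_iff_map_eq_zero _).2 fun μ hμ => ext_inner_right ℝ fun y => ?_
  obtain ⟨k, rfl⟩ := h y
  rw [← inner_jacT, hμ, inner_zero_left, inner_zero_left]

theorem fderiv_jacT_injective (h : Function.Surjective (fderiv ℝ g p)) {μ : E s}
    (hμ : fderiv ℝ g p (jacT g p μ) = 0) : μ = 0 := by
  have h1 : inner ℝ (jacT g p μ) (jacT g p μ) = 0 := by
    rw [inner_jacT, hμ, inner_zero_right]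
  exact jacT_injective h (by rw [inner_self_eq_zero.1 h1, map_zero])

/-- `∇g ∇g^*` is injective on a finite-dimensional space, hence onto; solve `∇g ∇g^* μ = ∇g c` and
put the rest in the kernel. -/
theorem exists_jacT_add_ker (h : Function.Surjective (fderiv ℝ g p)) (c : E n) :
    ∃ (μ : E s) (κ : (fderiv ℝ g p).ker), jacT g p μ + κ = c := by
  have hinj : Function.Injective ((fderiv ℝ g p).toLinearMap ∘ₗ (jacT g p).toLinearMap) :=
    (injective_iff_map_eq_zero _).2 fun μ hμ => fderiv_jacT_injective h hμ
  obtain ⟨μ, hμ⟩ := LinearMap.injective_iff_surjective.1 hinj (fderiv ℝ g p c)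
  have hμ : fderiv ℝ g p (jacT g p μ) = fderiv ℝ g p c := hμ
  refine ⟨μ, ⟨c - jacT g p μ, ?_⟩, by simp⟩
  simp [hμ]

/-- The kernel stays that of the base point while the Jacobian varies. The combined map is injective
at `p`, and injectivity is an open condition. -/
theorem eventually_jacT_add_ker_injective (hg : ContDiffAt ℝ 1 g p)
    (h : Function.Surjective (fderiv ℝ g p)) :
    ∀ᶠ x in 𝓝 p, ∀ (μ : E s) (κ : (fderiv ℝ g p).ker), jacT g x μ + κ = 0 → μ = 0 ∧ κ = 0 := by
  let M : E n → (WithLp 2 (E s × (fderiv ℝ g p).ker) →L[ℝ] E n) := fun x =>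
    (jacT g x).comp (WithLp.fstL 2 ℝ _ _) +
      (fderiv ℝ g p).ker.subtypeL.comp (WithLp.sndL 2 ℝ _ _)
  have hjac : Tendsto (jacT g) (𝓝 p) (𝓝 (jacT g p)) :=
    (ContinuousLinearMap.adjoint.continuous.tendsto _).comp
      (hg.fderiv_right (m := 0) (by simp)).continuousAt.tendsto
  have hM : Tendsto M (𝓝 p) (𝓝 (M p)) :=
    (tendsto_clm_comp hjac tendsto_const_nhds).add tendsto_const_nhds
  have hp : Function.Injective (M p) := by
    refine (injective_iff_map_eq_zero _).2 fun w hw => ?_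
    have hw : jacT g p w.fst + (w.snd : E n) = 0 := hw
    have h1 : fderiv ℝ g p (jacT g p w.fst) = 0 := by
      have h2 : fderiv ℝ g p (w.snd : E n) = 0 := w.snd.2
      have := congrArg (fderiv ℝ g p) hw
      rwa [map_add, h2, add_zero, map_zero] at this
    have h3 := fderiv_jacT_injective h h1
    rw [h3, map_zero, zero_add] at hw
    have h4 : w.snd = 0 := Subtype.ext hw
    calc w = WithLp.toLp 2 (w.fst, w.snd) := rfl
      _ = 0 := by rw [h3, h4]; rfl
  filter_upwards [hM.eventually (ContinuousLinearMap.isOpen_injective.mem_nhds hp)] with x hx μ κ hμ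
  have h5 : WithLp.toLp 2 (μ, κ) = 0 := (injective_iff_map_eq_zero (M x)).1 hx _ hμ
  exact ⟨congrArg WithLp.fst h5, congrArg WithLp.snd h5⟩

theorem surjective_fderiv_of_jacT (h : ∀ μ, jacT g x μ = 0 → μ = 0) :
    Function.Surjective (fderiv ℝ g x) := by
  have h1 : (fderiv ℝ g x).rangeᗮ = ⊥ := by
    rw [ContinuousLinearMap.orthogonal_range, eq_bot_iff]
    exact fun μ hμ => h μ hμ
  exact LinearMap.range_eq_top.1 (Submodule.orthogonal_eq_bot_iff.1 h1)

theorem closedNear_constraintSet (hg : ContDiffAt ℝ 1 g p) : ClosedNear (constraintSet g) p :=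
  ClosedNear.preimage (Ω := orthant s) (Φ := g)
    ((hg.eventually (by simp)).mono fun _ h => h.continuousAt)
    ⟨Set.univ, univ_mem, by simpa using isClosed_orthant⟩ (Eventually.of_forall fun _ => Iff.rfl)

/-- The normal cone to a constraint set with surjective Jacobian. -/
theorem mem_normalCone_constraintSet (hg : ContDiffAt ℝ 1 g x)
    (h : Function.Surjective (fderiv ℝ g x)) {v : E n} :
    v ∈ normalCone (constraintSet g) x ↔ ∃ μ, Complementary (g x) μ ∧ jacT g x μ = v := by
  rw [mem_normalCone_preimage_iff (S := constraintSet g) (Φ := g) (Ω := orthant s) hg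
    (hg.differentiableAt (by simp)).hasFDerivAt h
    ⟨Set.univ, univ_mem, by simpa using isClosed_orthant⟩ (Eventually.of_forall fun _ => Iff.rfl)]
  refine exists_congr fun μ => and_congr mem_normalCone_orthant ⟨fun hv => ?_, fun hv k => ?_⟩
  · exact ext_inner_right ℝ fun k => by rw [hv, inner_jacT]
  · rw [← hv, inner_jacT]

/-- The map `(x, μ, κ) ↦ (x, ∇g(x)^* μ + κ)` which parametrizes the graph of the normal cone
mapping near a point. -/
noncomputable def normalParam (g : E n → E s) (K : Submodule ℝ (E n))
    (z : WithLp 2 (E n × WithLp 2 (E s × K))) : WithLp 2 (E n × E n) :=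
  WithLp.toLp 2 (z.fst, ∑ i, z.snd.fst i • grad g i z.fst + (z.snd.snd : E n))

theorem contDiffAt_normalParam (hg : ContDiffAt ℝ 2 g p) (K : Submodule ℝ (E n))
    (w : WithLp 2 (E s × K)) : ContDiffAt ℝ 1 (normalParam g K) (WithLp.toLp 2 (p, w)) := by
  have h1 : ContDiffAt ℝ 1 (fun z : WithLp 2 (E n × WithLp 2 (E s × K)) => z.fst)
      (WithLp.toLp 2 (p, w)) := (WithLp.fstL 2 ℝ (E n) (WithLp 2 (E s × K))).contDiff.contDiffAt
  have h2 : ContDiffAt ℝ 1 (fun z : WithLp 2 (E n × WithLp 2 (E s × K)) => (z.snd.snd : E n))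
      (WithLp.toLp 2 (p, w)) :=
    (K.subtypeL.comp ((WithLp.sndL 2 ℝ (E s) K).comp
      (WithLp.sndL 2 ℝ (E n) (WithLp 2 (E s × K))))).contDiff.contDiffAt
  have h3 : ∀ i, ContDiffAt ℝ 1 (fun z : WithLp 2 (E n × WithLp 2 (E s × K)) => z.snd.fst i)
      (WithLp.toLp 2 (p, w)) := fun i =>
    ((EuclideanSpace.proj i : E s →L[ℝ] ℝ).comp
      ((WithLp.fstL 2 ℝ (E s) K).comp
        (WithLp.sndL 2 ℝ (E n) (WithLp 2 (E s × K))))).contDiff.contDiffAt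
  have h4 : ContDiffAt ℝ 1 (fun z : WithLp 2 (E n × WithLp 2 (E s × K)) =>
      (z.fst, ∑ i, z.snd.fst i • grad g i z.fst + (z.snd.snd : E n))) (WithLp.toLp 2 (p, w)) := by
    refine h1.prodMk (ContDiffAt.add (ContDiffAt.sum fun i _ => (h3 i).smul ?_) h2)
    exact ContDiffAt.comp (WithLp.toLp 2 (p, w)) (contDiffAt_grad hg i) h1
  exact (WithLp.prodContinuousLinearEquiv 2 ℝ (E n) (E n)).symm.contDiff.contDiffAt.comp _ h4

theorem hasFDerivAt_normalParam (hg : ContDiffAt ℝ 2 g p) (K : Submodule ℝ (E n))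
    (w : WithLp 2 (E s × K)) :
    ∃ A : WithLp 2 (E n × WithLp 2 (E s × K)) →L[ℝ] WithLp 2 (E n × E n),
      HasFDerivAt (normalParam g K) A (WithLp.toLp 2 (p, w)) ∧
      ∀ k, A k = WithLp.toLp 2 (k.fst,
        (∑ i, w.fst i • hess g i p) k.fst + jacT g p k.snd.fst + (k.snd.snd : E n)) := by
  have h1 : HasFDerivAt (fun z : WithLp 2 (E n × WithLp 2 (E s × K)) => z.fst)
      (WithLp.fstL 2 ℝ _ _) (WithLp.toLp 2 (p, w)) := (WithLp.fstL 2 ℝ _ _).hasFDerivAt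
  have h2 := (K.subtypeL.comp ((WithLp.sndL 2 ℝ (E s) K).comp
    (WithLp.sndL 2 ℝ (E n) (WithLp 2 (E s × K))))).hasFDerivAt (x := WithLp.toLp 2 (p, w))
  have h3 := fun i => ((EuclideanSpace.proj i : E s →L[ℝ] ℝ).comp
      ((WithLp.fstL 2 ℝ (E s) K).comp (WithLp.sndL 2 ℝ (E n) (WithLp 2 (E s × K))))).hasFDerivAt
        (x := WithLp.toLp 2 (p, w))
  have h4 := fun i => HasFDerivAt.comp (g := grad g i)
    (f := fun z : WithLp 2 (E n × WithLp 2 (E s × K)) => z.fst)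
    (WithLp.toLp 2 (p, w)) (hasFDerivAt_grad hg i) h1
  have h5 := (HasFDerivAt.fun_sum (u := Finset.univ) fun i _ => (h3 i).smul (h4 i)).add h2
  have h6 := (WithLp.prodContinuousLinearEquiv 2 ℝ (E n) (E n)).symm.hasFDerivAt.comp _
    (h1.prodMk h5)
  refine ⟨_, h6, fun k => ?_⟩
  rw [jacT_eq_sum (hg.differentiableAt (by simp))]
  apply (WithLp.prodContinuousLinearEquiv 2 ℝ (E n) (E n)).injective
  simp [Finset.sum_add_distrib]

/-- Near `p` the Jacobian stays surjective, so normals have the form `∇g(x)^* μ'`; uniqueness of the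
decomposition then forces `κ = 0` and `μ = μ'`. -/
theorem normalParam_mem_gph_iff (hg : ContDiffAt ℝ 1 g p)
    (h : Function.Surjective (fderiv ℝ g p)) (w : WithLp 2 (E s × (fderiv ℝ g p).ker)) :
    ∀ᶠ z in 𝓝 (WithLp.toLp 2 (p, w)),
      normalParam g (fderiv ℝ g p).ker z ∈ gph (normalCone (constraintSet g)) ↔
        WithLp.toLp 2 (g z.fst, z.snd) ∈ complementaritySet s (fderiv ℝ g p).ker := by
  have h1 : Tendsto (fun z : WithLp 2 (E n × WithLp 2 (E s × (fderiv ℝ g p).ker)) => z.fst)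
      (𝓝 (WithLp.toLp 2 (p, w))) (𝓝 p) := (WithLp.fstL 2 ℝ _ _).continuous.tendsto _
  filter_upwards [h1.eventually ((hg.eventually (by simp)).and
    (eventually_jacT_add_ker_injective hg h))] with z ⟨hz1, hz2⟩
  have hd : DifferentiableAt ℝ g z.fst := hz1.differentiableAt (by simp)
  have hs : Function.Surjective (fderiv ℝ g z.fst) :=
    surjective_fderiv_of_jacT fun μ hμ => (hz2 μ 0 (by simpa using hμ)).1
  change ∑ i, z.snd.fst i • grad g i z.fst + (z.snd.snd : E n) ∈
    normalCone (constraintSet g) z.fst ↔ Complementary (g z.fst) z.snd.fst ∧ z.snd.snd = 0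
  rw [mem_normalCone_constraintSet hz1 hs, ← jacT_eq_sum hd]
  constructor
  · rintro ⟨μ, hμ, he⟩
    obtain ⟨h2, h3⟩ := hz2 (z.snd.fst - μ) z.snd.snd (by
      rw [map_sub, he]; abel)
    rw [sub_eq_zero.1 h2]
    exact ⟨hμ, h3⟩
  · rintro ⟨hμ, h0⟩
    exact ⟨_, hμ, by rw [h0]; simp⟩

/-- The normal cone to the graph of the normal cone mapping of a constraint set. -/
theorem mem_normalCone_gph_normalCone_iff (hg : ContDiffAt ℝ 2 g p)
    (h : Function.Surjective (fderiv ℝ g p)) {μ : E s} (hμ : Complementary (g p) μ) {ζ η : E n} :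
    WithLp.toLp 2 (ζ, η) ∈
        normalCone (gph (normalCone (constraintSet g))) (WithLp.toLp 2 (p, jacT g p μ)) ↔
      ∃ α : E s, ζ + (∑ i, μ i • hess g i p) η = jacT g p α ∧
        ∀ i, (0 < g p i → α i = 0) ∧ (μ i < 0 → fderiv ℝ g p η i = 0) ∧
          ((α i ≤ 0 ∧ 0 ≤ fderiv ℝ g p η i) ∨ α i = 0 ∨ fderiv ℝ g p η i = 0) := by
  have hg1 : ContDiffAt ℝ 1 g p := hg.of_le (by norm_num)
  have hd : DifferentiableAt ℝ g p := hg.differentiableAt (by simp)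
  set K := (fderiv ℝ g p).ker
  set H := ∑ i, μ i • hess g i p with hH
  have hHsymm : ∀ ξ η : E n, inner ℝ (H ξ) η = inner ℝ ξ (H η) := by
    intro ξ η
    simp only [hH, FunLike.coe_sum, Finset.sum_apply, FunLike.coe_smul, Pi.smul_apply, sum_inner,
      inner_sum, real_inner_smul_left, real_inner_smul_right, inner_hess_comm hg]
  let z₀ : WithLp 2 (E n × WithLp 2 (E s × K)) := WithLp.toLp 2 (p, WithLp.toLp 2 (μ, 0))
  let S : Set (WithLp 2 (E n × WithLp 2 (E s × K))) :=
    normalParam g K ⁻¹' gph (normalCone (constraintSet g))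
  have hz₀ : normalParam g K z₀ = WithLp.toLp 2 (p, jacT g p μ) := by
    rw [jacT_eq_sum hd]; simp [normalParam, z₀]
  obtain ⟨A, hA, hAk⟩ := hasFDerivAt_normalParam hg K (WithLp.toLp 2 (μ, 0))
  have hAsurj : Function.Surjective A := by
    intro y
    obtain ⟨μ', κ, hc⟩ := exists_jacT_add_ker h (y.snd - H y.fst)
    refine ⟨WithLp.toLp 2 (y.fst, WithLp.toLp 2 (μ', κ)), ?_⟩
    rw [hAk]
    change WithLp.toLp 2 (y.fst, H y.fst + jacT g p μ' + (κ : E n)) = y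
    rw [add_assoc, hc, add_sub_cancel]
    rfl
  -- First description of `S`: the preimage of the graph under `normalParam`. The second, `rule2`,
  -- is local, through `Ψ` and the complementarity set.
  have rule1 := fun ω => mem_normalCone_preimage_iff (S := S) (ξ := ω)
    (contDiffAt_normalParam hg K (WithLp.toLp 2 (μ, 0))) hA hAsurj
    (Ω := gph (normalCone (constraintSet g)))
    (by
      change ClosedNear _ (normalParam g K z₀)
      rw [hz₀]
      exact closedNear_gph_normalCone (closedNear_constraintSet hg1))
    (Eventually.of_forall fun _ => Iff.rfl)
  change ∀ ω, ω ∈ normalCone S z₀ ↔ ∃ v ∈ normalCone _ (normalParam g K z₀), _ at rule1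
  rw [hz₀] at rule1
  let Ψ : WithLp 2 (E n × WithLp 2 (E s × K)) → WithLp 2 (E s × WithLp 2 (E s × K)) :=
    fun z => WithLp.toLp 2 (g z.fst, z.snd)
  let B : WithLp 2 (E n × WithLp 2 (E s × K)) →L[ℝ] WithLp 2 (E s × WithLp 2 (E s × K)) :=
    (WithLp.prodContinuousLinearEquiv 2 ℝ (E s) (WithLp 2 (E s × K))).symm.toContinuousLinearMap.comp
      (((fderiv ℝ g p).comp (WithLp.fstL 2 ℝ _ _)).prod (WithLp.sndL 2 ℝ _ _))
  have hfst : ContDiffAt ℝ 1 (fun z : WithLp 2 (E n × WithLp 2 (E s × K)) => z.fst) z₀ :=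
    (WithLp.fstL 2 ℝ (E n) (WithLp 2 (E s × K))).contDiff.contDiffAt
  have hΨ : ContDiffAt ℝ 1 Ψ z₀ :=
    (WithLp.prodContinuousLinearEquiv 2 ℝ (E s) (WithLp 2 (E s × K))).symm.contDiff.contDiffAt.comp
      z₀ ((ContDiffAt.comp z₀ hg1 hfst).prodMk (WithLp.sndL 2 ℝ (E n) (WithLp 2 (E s × K))).contDiff.contDiffAt)
  have hB : HasFDerivAt Ψ B z₀ :=
    (WithLp.prodContinuousLinearEquiv 2 ℝ (E s) (WithLp 2 (E s × K))).symm.hasFDerivAt.comp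
      z₀ ((HasFDerivAt.comp z₀ hd.hasFDerivAt (WithLp.fstL 2 ℝ _ _).hasFDerivAt).prodMk
        (WithLp.sndL 2 ℝ _ _).hasFDerivAt)
  have hBsurj : Function.Surjective B := by
    intro y
    obtain ⟨ξ, hξ⟩ := h y.fst
    refine ⟨WithLp.toLp 2 (ξ, y.snd), ?_⟩
    change WithLp.toLp 2 (fderiv ℝ g p ξ, y.snd) = y
    rw [hξ]
    rfl
  have rule2 := fun ω => mem_normalCone_preimage_iff (S := S) (ξ := ω) hΨ hB hBsurj
    (Ω := complementaritySet s K) ⟨Set.univ, univ_mem, by simpa using isClosed_complementaritySet⟩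
    (normalParam_mem_gph_iff hg1 h (WithLp.toLp 2 (μ, 0)))
  have eA : ∀ k, inner ℝ (WithLp.toLp 2 (ζ, η)) (A k) = inner ℝ (ζ + H η) k.fst +
      (inner ℝ (fderiv ℝ g p η) k.snd.fst + inner ℝ η (k.snd.snd : E n)) := by
    intro k
    rw [hAk, WithLp.prod_inner_apply]
    change inner ℝ ζ k.fst + inner ℝ η (H k.fst + jacT g p k.snd.fst + (k.snd.snd : E n)) = _
    rw [inner_add_right, inner_add_right, inner_add_left, hHsymm,
      real_inner_comm (jacT g p k.snd.fst), inner_jacT, real_inner_comm k.snd.fst]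
    ring
  have eB : ∀ (α β : E s) (γ : K) k, inner ℝ (WithLp.toLp 2 (α, WithLp.toLp 2 (β, γ))) (B k) =
      inner ℝ (jacT g p α) k.fst + (inner ℝ β k.snd.fst + inner ℝ γ k.snd.snd) := by
    intro α β γ k
    rw [inner_triple, inner_jacT]
    rfl
  constructor
  · intro hmem
    have h1 := (rule1 (ContinuousLinearMap.adjoint A (WithLp.toLp 2 (ζ, η)))).2
      ⟨_, hmem, fun k => ContinuousLinearMap.adjoint_inner_left _ _ _⟩
    obtain ⟨v, hv, hvk⟩ := (rule2 _).1 h1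
    have hvk' : ∀ k, inner ℝ (WithLp.toLp 2 (ζ, η)) (A k) =
        inner ℝ (WithLp.toLp 2 (v.fst, WithLp.toLp 2 (v.snd.fst, v.snd.snd))) (B k) := fun k => by
      rw [← ContinuousLinearMap.adjoint_inner_left, hvk]
      rfl
    have hv' : WithLp.toLp 2 (v.fst, WithLp.toLp 2 (v.snd.fst, v.snd.snd)) ∈
      normalCone (complementaritySet s K)
        (WithLp.toLp 2 (g p, WithLp.toLp 2 (μ, 0))) := hv
    simp only [eA, eB] at hvk'
    have hα : ζ + H η = jacT g p v.fst := by
      refine ext_inner_right ℝ fun ξ => ?_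
      simpa using hvk' (WithLp.toLp 2 (ξ, 0))
    have hβ : fderiv ℝ g p η = v.snd.fst := by
      refine ext_inner_right ℝ fun ξ => ?_
      simpa using hvk' (WithLp.toLp 2 (0, WithLp.toLp 2 (ξ, 0)))
    refine ⟨v.fst, hα, ?_⟩
    rw [hβ]
    exact (mem_normalCone_complementaritySet.1 hv').2
  · rintro ⟨α, hα, hLN⟩
    -- The `K`-component of `A^* (ζ, η)`, namely the orthogonal projection of `η` onto `K`; any
    -- value is allowed on the complementarity side.
    let γ : K := ContinuousLinearMap.adjoint K.subtypeL η
    have hmem : WithLp.toLp 2 (α, WithLp.toLp 2 (fderiv ℝ g p η, γ)) ∈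
        normalCone (complementaritySet s K) (Ψ z₀) :=
      mem_normalCone_complementaritySet.2 ⟨hμ, hLN⟩
    have h1 := (rule2 (ContinuousLinearMap.adjoint B
      (WithLp.toLp 2 (α, WithLp.toLp 2 (fderiv ℝ g p η, γ))))).2
      ⟨_, hmem, fun k => ContinuousLinearMap.adjoint_inner_left _ _ _⟩
    obtain ⟨v, hv, hvk⟩ := (rule1 _).1 h1
    -- Surjectivity of `A` makes `A^*` injective, so `v` is determined by its image.
    have hveq : v = WithLp.toLp 2 (ζ, η) := by
      refine ext_inner_right ℝ fun y => ?_
      obtain ⟨k, rfl⟩ := hAsurj y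
      rw [← hvk, ContinuousLinearMap.adjoint_inner_left, eA, eB, hα,
        ContinuousLinearMap.adjoint_inner_left]
      rfl
    rw [← hveq]
    exact hv

end ConstraintSystem

/-! ### Coderivatives of the normal cone and velocity mappings -/

section Velocity

set_option synthInstance.maxHeartbeats 200000

variable {n m d s : ℕ} {g : E n → E s} {p : E n}

/-- The planar condition for one index, with multiplier `-μ`, normal component `-σ` and direction
`-e`. The minus signs come from `λ = -μ` and from `-z` in the coderivative; the part `μ * e = 0`
becomes the domain condition. -/
theorem sign_conditions_iff {c μ σ e : ℝ} (hc : 0 ≤ c) (hμ : 0 ≤ μ) :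
    ((0 < c → -σ = 0) ∧ (-μ < 0 → -e = 0) ∧ ((-σ ≤ 0 ∧ 0 ≤ -e) ∨ -σ = 0 ∨ -e = 0)) ↔
      μ * e = 0 ∧ ((0 < c ∨ (μ = 0 ∧ 0 < e)) → σ = 0) ∧ ((c = 0 ∧ μ = 0 ∧ e < 0) → 0 ≤ σ) := by
  simp only [neg_eq_zero, Left.neg_neg_iff, Left.neg_nonpos_iff, Left.nonneg_neg_iff, mul_eq_zero]
  constructor
  · rintro ⟨h1, h2, h3⟩
    refine ⟨?_, ?_, ?_⟩
    · rcases hμ.eq_or_lt with h0 | h0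
      · exact Or.inl h0.symm
      · exact Or.inr (h2 h0)
    · rintro (h4 | ⟨-, h4⟩)
      · exact h1 h4
      · rcases h3 with h3 | h3 | h3
        · linarith [h3.2]
        · exact h3
        · linarith
    · rintro ⟨-, -, h4⟩
      rcases h3 with h3 | h3 | h3
      · exact h3.1
      · exact h3.ge
      · linarith
  · rintro ⟨h1, h2, h3⟩
    refine ⟨fun h4 => h2 (Or.inl h4), fun h4 => h1.resolve_left h4.ne', ?_⟩
    rcases h1 with h1 | h1
    · rcases hc.eq_or_lt with h0 | h0
      · rcases lt_trichotomy e 0 with he | he | he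
        · exact Or.inl ⟨h3 ⟨h0.symm, h1, he⟩, he.le⟩
        · exact Or.inr (Or.inr he)
        · exact Or.inr (Or.inl (h2 (Or.inr ⟨h1, he⟩)))
      · exact Or.inr (Or.inl (h2 (Or.inl h0)))
    · exact Or.inr (Or.inr h1)

/-- The coderivative of the normal cone mapping of a constraint set. -/
theorem mem_coderivative_normalCone_iff (hg : ContDiffAt ℝ 2 g p)
    (h : Function.Surjective (fderiv ℝ g p)) {μ : E s} (hμ : Complementary (g p) (-μ))
    {ζ z : E n} :
    ζ ∈ coderivative (normalCone (constraintSet g)) p (-(jacT g p μ)) z ↔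
      ∃ σ : E s, ζ = -((∑ i, μ i • hess g i p) z) - jacT g p σ ∧
        (∀ i, μ i * inner ℝ (grad g i p) z = 0) ∧ SignConditions g p μ z σ := by
  change WithLp.toLp 2 (ζ, -z) ∈ normalCone _ (WithLp.toLp 2 (p, -(jacT g p μ))) ↔ _
  rw [← map_neg, mem_normalCone_gph_normalCone_iff hg h hμ]
  have hd : DifferentiableAt ℝ g p := hg.differentiableAt (by simp)
  have hH : (∑ i, (-μ) i • hess g i p) (-z) = (∑ i, μ i • hess g i p) z := by
    simp
  rw [hH]
  refine (Equiv.neg (E s)).exists_congr fun α => ?_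
  have he : ζ + (∑ i, μ i • hess g i p) z = jacT g p α ↔
      ζ = -((∑ i, μ i • hess g i p) z) - jacT g p (Equiv.neg (E s) α) := by
    rw [Equiv.neg_apply, map_neg, sub_neg_eq_add, neg_add_eq_sub, eq_sub_iff_add_eq]
  rw [he, SignConditions, ← forall_and]
  refine and_congr_right fun _ => forall_congr' fun i => ?_
  obtain ⟨h1, h2, -⟩ := hμ i
  have h2' : 0 ≤ μ i := by simpa using h2
  rw [← sign_conditions_iff h1 h2', inner_grad hd, map_neg]
  simp

/-- The map `(x, y, u, a, b, w) ↦ (x - u, w - f₁(a, x) - y - h f₂(b, x))`. -/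
noncomputable def residual (f₁ : E m → E n → E n) (f₂ : E d → E n → E n) (h : ℝ)
    (r : WithLp 2 (Var n m d × E n)) : WithLp 2 (E n × E n) :=
  WithLp.toLp 2 (r.fst.fst - r.fst.snd.snd.fst,
    r.snd - f₁ r.fst.snd.snd.snd.fst r.fst.fst - r.fst.snd.fst
      - h • f₂ r.fst.snd.snd.snd.snd r.fst.fst)

variable {f₁ : E m → E n → E n} {f₂ : E d → E n → E n} {h : ℝ}

theorem gph_velocity : gph (velocity f₁ f₂ g h) =
    residual f₁ f₂ h ⁻¹' gph (normalCone (constraintSet g)) := by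
  ext r
  change r.snd ∈ (fun v => v + f₁ r.fst.snd.snd.snd.fst r.fst.fst + r.fst.snd.fst +
      h • f₂ r.fst.snd.snd.snd.snd r.fst.fst) '' normalCone (constraintSet g)
        (r.fst.fst - r.fst.snd.snd.fst) ↔
    r.snd - f₁ r.fst.snd.snd.snd.fst r.fst.fst - r.fst.snd.fst
      - h • f₂ r.fst.snd.snd.snd.snd r.fst.fst ∈ normalCone (constraintSet g)
        (r.fst.fst - r.fst.snd.snd.fst)
  constructor
  · rintro ⟨v, hv, hr⟩
    rw [← hr]
    convert hv using 1
    simp only []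
    abel
  · intro hv
    exact ⟨_, hv, by simp only []; abel⟩

/-- The components of `ℝ^{3n+m+d} × ℝⁿ` as continuous linear maps. -/
theorem exists_components (n m d : ℕ) :
    ∃ (X Y U W : WithLp 2 (Var n m d × E n) →L[ℝ] E n)
      (A : WithLp 2 (Var n m d × E n) →L[ℝ] E m) (B : WithLp 2 (Var n m d × E n) →L[ℝ] E d),
      (∀ r, X r = r.fst.fst) ∧ (∀ r, Y r = r.fst.snd.fst) ∧ (∀ r, U r = r.fst.snd.snd.fst) ∧
      (∀ r, W r = r.snd) ∧ (∀ r, A r = r.fst.snd.snd.snd.fst) ∧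
      (∀ r, B r = r.fst.snd.snd.snd.snd) := by
  let V₀ := WithLp.fstL 2 ℝ (Var n m d) (E n)
  let V₁ := (WithLp.sndL 2 ℝ (E n) (WithLp 2 (E n × WithLp 2 (E n × WithLp 2 (E m × E d))))).comp V₀
  let V₂ := (WithLp.sndL 2 ℝ (E n) (WithLp 2 (E n × WithLp 2 (E m × E d)))).comp V₁
  let V₃ := (WithLp.sndL 2 ℝ (E n) (WithLp 2 (E m × E d))).comp V₂
  exact ⟨(WithLp.fstL 2 ℝ _ _).comp V₀, (WithLp.fstL 2 ℝ _ _).comp V₁,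
    (WithLp.fstL 2 ℝ _ _).comp V₂, WithLp.sndL 2 ℝ _ _, (WithLp.fstL 2 ℝ _ _).comp V₃,
    (WithLp.sndL 2 ℝ _ _).comp V₃, fun _ => rfl, fun _ => rfl, fun _ => rfl, fun _ => rfl,
    fun _ => rfl, fun _ => rfl⟩

theorem residual_derivative (f₁ : E m → E n → E n) (f₂ : E d → E n → E n) (h : ℝ)
    {r : WithLp 2 (Var n m d × E n)} {x : E n} {a : E m} {b : E d}
    (hx : r.fst.fst = x) (ha : r.fst.snd.snd.snd.fst = a) (hb : r.fst.snd.snd.snd.snd = b)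
    (hf₁ : ContDiffAt ℝ 1 (Function.uncurry f₁) (a, x))
    (hf₂ : ContDiffAt ℝ 1 (Function.uncurry f₂) (b, x)) :
    ContDiffAt ℝ 1 (residual f₁ f₂ h) r ∧
    ∃ D : WithLp 2 (Var n m d × E n) →L[ℝ] WithLp 2 (E n × E n),
      HasFDerivAt (residual f₁ f₂ h) D r ∧ ∀ k, D k = WithLp.toLp 2
        (k.fst.fst - k.fst.snd.snd.fst, k.snd
          - fderiv ℝ (Function.uncurry f₁) (a, x) (k.fst.snd.snd.snd.fst, k.fst.fst)
          - k.fst.snd.fst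
          - h • fderiv ℝ (Function.uncurry f₂) (b, x) (k.fst.snd.snd.snd.snd, k.fst.fst)) := by
  obtain ⟨X, Y, U, W, A, B, hX, hY, hU, hW, hA, hB⟩ := exists_components n m d
  have e1 : (A.prod X) r = (a, x) := by simp [hA, hX, hx, ha]
  have e2 : (B.prod X) r = (b, x) := by simp [hB, hX, hx, hb]
  have hres : residual f₁ f₂ h = fun r =>
      (WithLp.prodContinuousLinearEquiv 2 ℝ (E n) (E n)).symm ((X - U) r,
        W r - Function.uncurry f₁ ((A.prod X) r) - Y r
          - h • Function.uncurry f₂ ((B.prod X) r)) := by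
    ext1 r
    simp [residual, hX, hY, hU, hW, hA, hB]
  rw [← e1] at hf₁
  rw [← e2] at hf₂
  have c1 := hf₁.comp r (A.prod X).contDiff.contDiffAt
  have c2 := hf₂.comp r (B.prod X).contDiff.contDiffAt
  have d1 := (hf₁.differentiableAt (by simp)).hasFDerivAt.comp r (A.prod X).hasFDerivAt
  have d2 := (hf₂.differentiableAt (by simp)).hasFDerivAt.comp r (B.prod X).hasFDerivAt
  constructor
  · rw [hres]
    exact (WithLp.prodContinuousLinearEquiv 2 ℝ (E n) (E n)).symm.contDiff.contDiffAt.comp r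
      ((X - U).contDiff.contDiffAt.prodMk
        (((W.contDiff.contDiffAt.sub c1).sub Y.contDiff.contDiffAt).sub (c2.const_smul h)))
  · rw [hres]
    refine ⟨_, (WithLp.prodContinuousLinearEquiv 2 ℝ (E n) (E n)).symm.hasFDerivAt.comp r
      ((X - U).hasFDerivAt.prodMk
        (((W.hasFDerivAt.sub d1).sub Y.hasFDerivAt).sub (d2.const_smul h))), fun k => ?_⟩
    apply (WithLp.prodContinuousLinearEquiv 2 ℝ (E n) (E n)).injective
    rw [e1, e2]
    simp [hX, hY, hU, hW, hA, hB]

theorem fderiv_uncurry_apply {X Y Z : Type*} [NormedAddCommGroup X] [NormedSpace ℝ X]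
    [NormedAddCommGroup Y] [NormedSpace ℝ Y] [NormedAddCommGroup Z] [NormedSpace ℝ Z]
    {f : X → Y → Z} {a : X} {x : Y} (hf : DifferentiableAt ℝ (Function.uncurry f) (a, x))
    (k : X × Y) : fderiv ℝ (Function.uncurry f) (a, x) k =
      fderiv ℝ (fun a' => f a' x) a k.1 + fderiv ℝ (fun x' => f a x') x k.2 := by
  have h1 : HasFDerivAt (fun a' => f a' x) _ a :=
    HasFDerivAt.comp (g := Function.uncurry f) (f := fun a' => (a', x)) a hf.hasFDerivAt
      (hasFDerivAt_prodMk_left a x)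
  have h2 : HasFDerivAt (fun x' => f a x') _ x :=
    HasFDerivAt.comp (g := Function.uncurry f) (f := fun x' => (a, x')) x hf.hasFDerivAt
      (hasFDerivAt_prodMk_right a x)
  rw [h1.fderiv, h2.fderiv, ContinuousLinearMap.comp_apply, ContinuousLinearMap.comp_apply,
    ← map_add]
  simp

theorem inner_var (x y u : E n) (a : E m) (b : E d) (w : E n)
    (k : WithLp 2 (Var n m d × E n)) :
    inner ℝ (WithLp.toLp 2 (var x y u a b, w)) k = inner ℝ x k.fst.fst +
      (inner ℝ y k.fst.snd.fst + (inner ℝ u k.fst.snd.snd.fst +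
        (inner ℝ a k.fst.snd.snd.snd.fst + inner ℝ b k.fst.snd.snd.snd.snd))) +
      inner ℝ w k.snd := by
  simp only [WithLp.prod_inner_apply, var]
  rfl

/-- The coderivative of the velocity mapping in terms of that of the normal cone mapping. -/
theorem mem_coderivative_velocity_iff {x y u w : E n} {a : E m} {b : E d}
    (hf₁ : ContDiffAt ℝ 1 (Function.uncurry f₁) (a, x))
    (hf₂ : ContDiffAt ℝ 1 (Function.uncurry f₂) (b, x)) (hg : ContDiffAt ℝ 1 g (x - u))
    {q : Var n m d} {z : E n} :
    q ∈ coderivative (velocity f₁ f₂ g h) (var x y u a b) w z ↔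
      ∃ ζ ∈ coderivative (normalCone (constraintSet g)) (x - u)
          (w - f₁ a x - y - h • f₂ b x) z,
        q = var (ζ + jacT (fun x' => f₁ a x') x z + h • jacT (fun x' => f₂ b x') x z) z (-ζ)
          (jacT (fun a' => f₁ a' x) a z) (h • jacT (fun b' => f₂ b' x) b z) := by
  obtain ⟨hC, D, hD, hDk⟩ := residual_derivative f₁ f₂ h
    (r := WithLp.toLp 2 (var x y u a b, w)) (x := x) (a := a) (b := b) rfl rfl rfl hf₁ hf₂
  have hres : residual f₁ f₂ h (WithLp.toLp 2 (var x y u a b, w)) =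
      WithLp.toLp 2 (x - u, w - f₁ a x - y - h • f₂ b x) := rfl
  have hDsurj : Function.Surjective D := by
    intro c
    -- Move `x` to reach the first component, then let `w` cancel the resulting change of `f₁` and
    -- `f₂`.
    refine ⟨WithLp.toLp 2 (var c.fst 0 0 0 0, c.snd
      + fderiv ℝ (Function.uncurry f₁) (a, x) (0, c.fst)
      + h • fderiv ℝ (Function.uncurry f₂) (b, x) (0, c.fst)), ?_⟩
    rw [hDk]
    change WithLp.toLp 2 (c.fst - 0, c.snd + fderiv ℝ (Function.uncurry f₁) (a, x) (0, c.fst)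
      + h • fderiv ℝ (Function.uncurry f₂) (b, x) (0, c.fst)
      - fderiv ℝ (Function.uncurry f₁) (a, x) (0, c.fst) - 0
      - h • fderiv ℝ (Function.uncurry f₂) (b, x) (0, c.fst)) = c
    calc _ = WithLp.toLp 2 (c.fst, c.snd) := by
          congr 2
          · abel
          · abel
      _ = c := rfl
  change WithLp.toLp 2 (q, -z) ∈ normalCone (gph (velocity f₁ f₂ g h))
    (WithLp.toLp 2 (var x y u a b, w)) ↔ _
  rw [gph_velocity, mem_normalCone_preimage_iff (Φ := residual f₁ f₂ h)
    (S := residual f₁ f₂ h ⁻¹' gph (normalCone (constraintSet g)))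
    (Ω := gph (normalCone (constraintSet g))) hC hD hDsurj
    (by rw [hres]; exact closedNear_gph_normalCone (closedNear_constraintSet hg))
    (Eventually.of_forall fun _ => Iff.rfl), hres]
  have d1 := hf₁.differentiableAt (by simp)
  have d2 := hf₂.differentiableAt (by simp)
  have key : ∀ ζ k, inner ℝ (WithLp.toLp 2 (ζ, -z)) (D k) = inner ℝ (WithLp.toLp 2
      (var (ζ + jacT (fun x' => f₁ a x') x z + h • jacT (fun x' => f₂ b x') x z) z (-ζ)
          (jacT (fun a' => f₁ a' x) a z) (h • jacT (fun b' => f₂ b' x) b z), -z)) k := by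
    intro ζ k
    rw [inner_var, hDk, WithLp.prod_inner_apply, fderiv_uncurry_apply d1, fderiv_uncurry_apply d2]
    simp only [inner_add_left, real_inner_smul_left, inner_jacT, inner_neg_left, inner_sub_right,
      inner_add_right, real_inner_smul_right]
    ring
  constructor
  · rintro ⟨v, hv, hk⟩
    -- The residual depends on `w` through the identity, so testing with pure `w` directions
    -- isolates this component.
    have hη : v.snd = -z := by
      refine ext_inner_right ℝ fun k => ?_
      have h1 := hk (WithLp.toLp 2 (0, k))
      rw [hDk, fderiv_uncurry_apply d1, fderiv_uncurry_apply d2] at h1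
      simp only [WithLp.prod_inner_apply] at h1
      simpa using h1.symm
    have hv' : v = WithLp.toLp 2 (v.fst, -z) := by rw [← hη]; rfl
    rw [hv'] at hv hk
    refine ⟨v.fst, hv, ?_⟩
    have h2 : WithLp.toLp 2 (q, -z) = WithLp.toLp 2 (_, -z) :=
      ext_inner_right ℝ fun k => (hk k).trans (key v.fst k)
    exact congrArg WithLp.fst h2
  · rintro ⟨ζ, hζ, rfl⟩
    exact ⟨_, hζ, fun k => (key ζ k).symm⟩

end Velocity

end Sweeping

/-! ### Assembly of the three claims -/

theorem theorem6p1 {n m d s : ℕ}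
    (f₁ : E m → E n → E n) (f₂ : E d → E n → E n) (g : E n → E s)
    (h : ℝ) (hh : 0 < h)
    (x y u : E n) (a : E m) (b : E d) (w : E n)
    (hxu : x - u ∈ constraintSet g)
    (hw : w ∈ velocity f₁ f₂ g h (var x y u a b))
    (hf₁ : ContDiffAt ℝ 1 (Function.uncurry f₁) (a, x))
    (hf₂ : ContDiffAt ℝ 1 (Function.uncurry f₂) (b, x))
    (hg : ContDiffAt ℝ 2 g (x - u))
    (hrank : Function.Surjective (fderiv ℝ g (x - u))) :
    (∃! μ : E s, IsMultiplier g (x - u) (w - f₁ a x - y - h • f₂ b x) μ) ∧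
    (dom (coderivative (normalCone (constraintSet g)) (x - u) (w - f₁ a x - y - h • f₂ b x)) =
      {z : E n | ∃ μ : E s, IsMultiplier g (x - u) (w - f₁ a x - y - h • f₂ b x) μ ∧
        ∀ i, μ i * inner ℝ (grad g i (x - u)) z = 0}) ∧
    (∀ μ : E s, IsMultiplier g (x - u) (w - f₁ a x - y - h • f₂ b x) μ →
      ∀ z ∈ dom (coderivative (normalCone (constraintSet g)) (x - u)
          (w - f₁ a x - y - h • f₂ b x)),
        coderivative (velocity f₁ f₂ g h) (var x y u a b) w z =
          {q : Var n m d | ∃ σ : E s, SignConditions g (x - u) μ z σ ∧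
            q = var
              (jacT (fun x' => f₁ a x') x z + h • jacT (fun x' => f₂ b x') x z
                - (∑ i, μ i • hess g i (x - u)) z - jacT g (x - u) σ)
              z
              ((∑ i, μ i • hess g i (x - u)) z + jacT g (x - u) σ)
              (jacT (fun a' => f₁ a' x) a z)
              (h • jacT (fun b' => f₂ b' x) b z)}) := by
  have hg1 : ContDiffAt ℝ 1 g (x - u) := hg.of_le (by norm_num)
  have hv : w - f₁ a x - y - h • f₂ b x ∈ normalCone (constraintSet g) (x - u) := by
    have h1 : WithLp.toLp 2 (var x y u a b, w) ∈ gph (velocity f₁ f₂ g h) := hw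
    rw [gph_velocity] at h1
    exact h1
  obtain ⟨ν, hν, hνv⟩ := (mem_normalCone_constraintSet hg1 hrank).1 hv
  obtain ⟨lam, rfl⟩ : ∃ lam, ν = -lam := ⟨-ν, (neg_neg ν).symm⟩
  rw [map_neg] at hνv
  have hmul : IsMultiplier g (x - u) (w - f₁ a x - y - h • f₂ b x) lam :=
    ⟨fun i => by simpa using (hν i).2.1, hνv⟩
  have huniq : ∀ μ, IsMultiplier g (x - u) (w - f₁ a x - y - h • f₂ b x) μ → μ = lam :=
    fun μ hμ => jacT_injective hrank (neg_injective (hμ.2.trans hνv.symm))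
  have hcod := fun ζ z => mem_coderivative_normalCone_iff (ζ := ζ) (z := z) hg hrank hν
  rw [hνv] at hcod
  refine ⟨⟨lam, hmul, huniq⟩, ?_, ?_⟩
  · ext z
    constructor
    · rintro ⟨ζ, hζ⟩
      obtain ⟨σ, -, h1, -⟩ := (hcod ζ z).1 hζ
      exact ⟨lam, hmul, h1⟩
    · rintro ⟨μ, hμ, h1⟩
      rw [huniq μ hμ] at h1
      -- `σ = 0` meets all sign conditions, so the orthogonality relations alone make the
      -- coderivative nonempty.
      exact ⟨_, (hcod _ z).2 ⟨0, rfl, h1, fun i => ⟨fun _ => rfl, fun _ => le_rfl⟩⟩⟩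
  · rintro μ hμ z ⟨ζ₀, hζ₀⟩
    rw [huniq μ hμ]
    -- Membership of `z` in the domain supplies the orthogonality relations, which do not involve
    -- `σ` and so serve every `σ` below.
    obtain ⟨-, -, horth, -⟩ := (hcod ζ₀ z).1 hζ₀
    ext q
    rw [mem_coderivative_velocity_iff hf₁ hf₂ hg1]
    constructor
    · rintro ⟨ζ, hζ, rfl⟩
      obtain ⟨σ, rfl, -, hσ⟩ := (hcod ζ z).1 hζ
      refine ⟨σ, hσ, ?_⟩
      congr 1
      · abel
      · abel
    · rintro ⟨σ, hσ, rfl⟩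
      refine ⟨_, (hcod _ z).2 ⟨σ, rfl, horth, hσ⟩, ?_⟩
      congr 1
      · abel
      · abel
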